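/- **Setting.** An instance $(x_0,(f,f';h))$ consists of a dimension $n\ge 1$, functions $f,h:\mathbb R^n\to(-\infty,+\infty]$, a map $f':\operatorname{dom}h\to\mathbb R^n$ and a point $x_0\in\operatorname{dom}h$. Put $\phi=f+h$, $\phi^*=\inf\phi$, let $X^*$ be the set of minimizers of $\phi$ and $d_0=\operatorname{dist}(x_0,X^*)$. A point $x$ is an $\bar\varepsilon$-solution if $\phi(x)-\phi^*\le\bar\varepsilon$. For $M_f,\mu\ge0$ and $R_0>0$: * $\mathcal I_\mu(M_f,R_0)$ is the class of all instances (of all dimensions) such that $f,h$ are proper, lower semicontinuous and convex, $\operatorname{dom}h\subseteq\operatorname{dom}f$, $f'(x)\in\partial f(x)$ and $\|f'(x)\|\le M_f$ for all $x\in\operatorname{dom}h$, $h$ is $\mu$-convex, $X^*\neq\emptyset$ and $d_0\le R_0$; * $\mathcal I^u_\mu(M_f,R_0)$ is the subclass of those with $h=\mu\|\cdot\|^2/2$ on $\mathbb R^n$; * $\mathcal I_0(M_f,R_0;C)$ is the subclass of those instances of $\mathcal I_0(M_f,R_0)$ for which $h$ is $M_h$-Lipschitz on $\operatorname{dom}h$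 for some $0\le M_h\le CM_f$. **Optimality.** For a class $\mathcal I$ of instances, $\mathcal A(\mathcal I,\bar\varepsilon)$ is the set of algorithms which, for every instance in $\mathcal I$, start from $x_0$ and generate a finite sequence $x_0,\dots,x_{J-1}$, $J\ge1$, such that $x_{J-1}$ is its only term that is an $\bar\varepsilon$-solution and, if $h$ is quadratic with Hessian a multiple of the identity, $x_j\in x_0+\operatorname{Lin}\{f'(x_0),\dots,f'(x_{j-1}),\nabla h(x_0),\dots,\nabla h(x_{j-1})\}$ for $1\le j\le J-1$. An upper bound for $\mathcal A$ on $\mathcal I$ is an upper bound on $J$ over all instances in $\mathcal I$; an upper bound for $\mathcal I$ is one for some algorithm in $\mathcal A(\mathcal I,\bar\varepsilon)$; a lower bound for $\mathcal I$ is a number which, for some instance in $\mathcal I$, is at most the $J$ of every algorithm in $\mathcal A(\mathcal I,\bar\varepsilon)$ on it. An algorithm is $\bar\varepsilon$-optimal for $\mathcal I$ up to a factor $\ell$, with constant $c$, if it belongs to $\mathcal A(\mathcal I,\bar\varepsilon)$ and there are lower and upper bounds $M_1,M_2$ for $\mathcal I$ with $M_2\le c\,\ell M_1$ such that $cM_2$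 is an upper bound for the algorithm on $\mathcal I$. It is $\bar\varepsilon$-optimal if $\ell=1$. **RPB$(x_0,\lambda,\delta)$.** Set $x^c_0=\tilde x_0=\hat z=x_0$, $C_1=\{x_0\}$. For $j=1,2,\dots$: let $f_j(u)=\max\{f(x)+\langle f'(x),u-x\rangle:x\in C_j\}$; let $x_j$ minimize $f_j+h+\frac1{2\lambda}\|\cdot-x^c_{j-1}\|^2$, with minimum value $m_j$; with $\phi^\lambda_j=\phi+\frac1{2\lambda}\|\cdot-x^c_{j-1}\|^2$ choose $\tilde x_j\in\operatorname{Argmin}\{\phi^\lambda_j(u):u\in\{x_j,\tilde x_{j-1}\}\}$. If $\phi_j^\lambda(\tilde x_j)-m_j\le\delta$ (serious iteration), choose any $C_{j+1}$ with $\{x_j\}\subseteq C_{j+1}\subseteq\{x_0,\dots,x_j\}$, set $x^c_j=x_j$ and replace $\hat z$ by a minimizer of $\phi$ over $\{\hat z,\tilde x_j\}$; otherwise (null iteration) set $x^c_j=x^c_{j-1}$ and choose any $C_{j+1}$ with $A_j\cup\{x_j\}\subseteq C_{j+1}\subseteq C_j\cup\{x_j\}$, where $A_j=\{x\in C_j:f(x)+\langle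 f'(x),x_j-x\rangle=f_j(x_j)\}$. As an algorithm in the above sense, RPB outputs $x_0,x_1,\dots$ up to and including the first $\bar\varepsilon$-solution. **Theorem.** Let $C>0$. All constants $c>1$ below depend only on the indicated quantities. Let $\bar\varepsilon>0$, $M_f\ge0$, $R_0>0$ be such that $CM_fR_0/\bar\varepsilon\ge1$. (a) For every $C'>0$ there is $c=c(C,C')$ such that for all such $(\bar\varepsilon,M_f,R_0)$, all $\lambda\in[R_0/M_f,\;CR_0^2/\bar\varepsilon]$, all $\mu\in[0,C'M_f/R_0]$ and every class $\mathcal I$ with $\mathcal I^u_\mu(M_f,R_0)\subseteq\mathcal I\subseteq\mathcal I_\mu(M_f,R_0)$: RPB$(x_0,\lambda,\bar\varepsilon/2)$ is well defined on $\mathcal I$ and, however its free choices are made, it is $\bar\varepsilon$-optimal for $\mathcal I$ up to the logarithmic factor $\max\{\log(\mu R_0^2/\bar\varepsilon+1),1\}$ with constant $c$. Moreover, on every instance of $\mathcal I$ it obtains an $\bar\varepsilon$-solution $\hat z$ (initially or at a serious iteration) within $$c\left(\min\left\{\frac{M_f^2R_0^2}{\bar\varepsilon^2},\Big(\frac{M_f^2}{\mu\bar\varepsilon}+1\Big)\log\Big(\frac{\mu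 R_0^2}{\bar\varepsilon}+1\Big)\right\}+1\right)$$ iterations, where for $\mu=0$ the second term is understood as the first. (b) There is $c=c(C)$ such that for all such $(\bar\varepsilon,M_f,R_0)$, all $\lambda\in[\bar\varepsilon/(CM_f^2),\;CR_0^2/\bar\varepsilon]$ and every class $\mathcal I$ with $\mathcal I^u_0(M_f,R_0)\subseteq\mathcal I\subseteq\mathcal I_0(M_f,R_0;C)$: RPB$(x_0,\lambda,\bar\varepsilon/2)$ is well defined on $\mathcal I$ and, however its free choices are made, it is $\bar\varepsilon$-optimal for $\mathcal I$ with constant $c$. Moreover, on every instance of $\mathcal I$ it obtains an $\bar\varepsilon$-solution $\hat z$ (initially or at a serious iteration) within $c\,(M_f^2R_0^2/\bar\varepsilon^2+1)$ iterations. -/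

import Mathlib

noncomputable section

namespace CNCO

/-- The Euclidean space `ℝⁿ`. -/
abbrev E (n : ℕ) : Type := EuclideanSpace ℝ (Fin n)

/-! ### Extended-real-valued convex functions -/

/-- The effective domain of `ψ`. -/
def edom {n : ℕ} (ψ : E n → EReal) : Set (E n) := {x | ψ x < ⊤}

/-- `ψ` is `μ`-convex. On the effective domain of a function that avoids `-∞` the values are
real numbers, so the right-hand side is the usual real expression. -/
def IsMuConvex {n : ℕ} (μ : ℝ) (ψ : E n → EReal) : Prop :=
  ∀ z ∈ edom ψ, ∀ u ∈ edom ψ, ∀ α : ℝ, 0 ≤ α → α ≤ 1 →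
    ψ (α • z + (1 - α) • u) ≤
      ((α * (ψ z).toReal + (1 - α) * (ψ u).toReal
        - α * (1 - α) * μ / 2 * ‖z - u‖ ^ 2 : ℝ) : EReal)

/-- Proper lower semicontinuous convex functions `ℝⁿ → (-∞, +∞]`. -/
def IsClosedConvex {n : ℕ} (ψ : E n → EReal) : Prop :=
  (∀ x, ψ x ≠ ⊥) ∧ (edom ψ).Nonempty ∧ LowerSemicontinuous ψ ∧ IsMuConvex 0 ψ

/-- The subdifferential of `ψ` at `x` (used at points of the effective domain). -/
def subdiff {n : ℕ} (ψ : E n → EReal) (x : E n) : Set (E n) :=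
  {s | ∀ u, ψ x + ((inner ℝ s (u - x) : ℝ) : EReal) ≤ ψ u}

/-! ### Instances -/

/-- The data `(x₀, (f, f'; h))` on `ℝⁿ` of a convex nonsmooth composite problem
`min {f(x) + h(x)}`. The dimension `n ≥ 1` is part of the data. The oracle `f'` only matters
on the effective domain of `h`. -/
structure Inst where
  n : ℕ
  n_pos : 0 < n
  f : E n → EReal
  h : E n → EReal
  f' : E n → E n
  x0 : E n

namespace Inst

variable (P : Inst)

/-- The objective `φ = f + h`. -/
def phi (x : E P.n) : EReal := P.f x + P.h x

/-- The set `X*` of optimal solutions. -/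
def argmin : Set (E P.n) := {x | ∀ u, P.phi x ≤ P.phi u}

/-- The optimal value `φ*`. -/
def phiStar : EReal := ⨅ x, P.phi x

/-- The distance `d₀` of `x₀` to the set of optimal solutions. -/
def d0 : ℝ := Metric.infDist P.x0 P.argmin

/-- `x` is an `ε`-solution: `φ(x) - φ* ≤ ε`. -/
def IsSol (ε : ℝ) (x : E P.n) : Prop := P.phi x ≤ P.phiStar + (ε : EReal)

/-- (A1) -/
def A1 : Prop :=
  IsClosedConvex P.f ∧ IsClosedConvex P.h ∧ edom P.h ⊆ edom P.f ∧
    ∀ x ∈ edom P.h, P.f' x ∈ subdiff P.f x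

/-- (A2) -/
def A2 : Prop := P.argmin.Nonempty

/-- (A3) -/
def A3 (Mf μ : ℝ) : Prop := IsMuConvex μ P.h ∧ ∀ x ∈ edom P.h, ‖P.f' x‖ ≤ Mf

/-- (A4) for a finite constant `Mh`. -/
def A4 (Mh : ℝ) : Prop :=
  ∀ u ∈ edom P.h, ∀ v ∈ edom P.h, |(P.h u).toReal - (P.h v).toReal| ≤ Mh * ‖u - v‖

end Inst

/-- The class `I_μ(M_f, R₀)`. -/
def instClass (μ Mf R0 : ℝ) : Set Inst :=
  {P | P.x0 ∈ edom P.h ∧ P.A1 ∧ P.A2 ∧ P.A3 Mf μ ∧ P.d0 ≤ R0}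

/-- The unconstrained class `I_μ^u(M_f, R₀)`: additionally `h = μ‖·‖²/2`. -/
def instClassU (μ Mf R0 : ℝ) : Set Inst :=
  {P | P ∈ instClass μ Mf R0 ∧ ∀ x, P.h x = ((μ / 2 * ‖x‖ ^ 2 : ℝ) : EReal)}

/-- The class `I_0(M_f, R₀; C)`: `h` is `M_h`-Lipschitz on its domain for some `M_h ≤ C M_f`. -/
def instClassLip (Mf R0 C : ℝ) : Set Inst :=
  {P | P ∈ instClass 0 Mf R0 ∧ ∃ Mh : ℝ, 0 ≤ Mh ∧ Mh ≤ C * Mf ∧ P.A4 Mh}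

/-! ### Algorithms and their complexity -/

/-- An algorithm assigns to every instance a finite sequence `x 0, …, x (J - 1)`. (The values
`x j` with `j ≥ J` are never used.) -/
structure Algorithm where
  J : Inst → ℕ
  x : (P : Inst) → ℕ → E P.n

/-- The class `𝒜(I, ε)`: on every instance of `I` the algorithm starts from `x₀` and generates a
finite sequence `x 0, …, x (J - 1)`, `J ≥ 1`, such that
(a) `x (J - 1)` is the only `ε`-solution among its terms, and
(b) if `h` is quadratic with Hessian `a • I`, that is, `h(y) = (a/2)‖y‖² + ⟪b, y⟫ + e` and
`∇h(y) = a y + b`, then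
`x j ∈ x₀ + Lin {f'(x 0), …, f'(x (j - 1)), ∇h(x 0), …, ∇h(x (j - 1))}`. -/
def algClass (I : Set Inst) (ε : ℝ) : Set Algorithm :=
  {A | ∀ P ∈ I,
    1 ≤ A.J P ∧ A.x P 0 = P.x0 ∧
    (∀ j < A.J P, (P.IsSol ε (A.x P j) ↔ j = A.J P - 1)) ∧
    (∀ (a : ℝ) (b : E P.n) (e : ℝ),
      (∀ y, P.h y = ((a / 2 * ‖y‖ ^ 2 + inner ℝ b y + e : ℝ) : EReal)) →
      ∀ j, 1 ≤ j → j < A.J P →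
        A.x P j - P.x0 ∈ Submodule.span ℝ
          {v | ∃ i < j, v = P.f' (A.x P i) ∨ v = a • A.x P i + b})}

/-- `B` is an upper complexity bound for the algorithm `A` with respect to `I`. -/
def IsAlgUpper (I : Set Inst) (A : Algorithm) (B : ℝ) : Prop :=
  ∀ P ∈ I, (A.J P : ℝ) ≤ B

/-- `B` is an `ε`-upper complexity bound for the class `I`. -/
def IsClassUpper (I : Set Inst) (ε B : ℝ) : Prop :=
  ∃ A ∈ algClass I ε, IsAlgUpper I A B

/-- `B` is an `ε`-lower complexity bound for the class `I`. -/
def IsClassLower (I : Set Inst) (ε B : ℝ) : Prop :=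
  ∃ P ∈ I, ∀ A ∈ algClass I ε, B ≤ (A.J P : ℝ)

/-- `A` is `ε`-optimal for `I` up to the factor `ℓ` with underlying constant `c`: `A ∈ 𝒜(I, ε)`
and there are `ε`-lower and `ε`-upper complexity bounds `M₁`, `M₂` for `I` with `M₂ ≤ c ℓ M₁`
such that `c M₂` is an upper complexity bound for `A`. Plain optimality is the case `ℓ = 1`. -/
def IsOptimalUpTo (c l : ℝ) (I : Set Inst) (ε : ℝ) (A : Algorithm) : Prop :=
  A ∈ algClass I ε ∧ ∃ M₁ M₂ : ℝ, IsClassLower I ε M₁ ∧ IsClassUpper I ε M₂ ∧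
    M₂ ≤ c * l * M₁ ∧ IsAlgUpper I A (c * M₂)

/-! ### The relaxed proximal bundle method -/

/-- The cutting-plane model `max {f(y) + ⟪f'(y), u - y⟫ : y ∈ S}` of a finite set `S`. -/
def cutModel (P : Inst) (S : Finset (E P.n)) (u : E P.n) : EReal :=
  S.sup fun y => P.f y + ((inner ℝ (P.f' y) (u - y) : ℝ) : EReal)

/-- The quantities generated by the method: the iterates `x j`, the prox-centers `xc j`, the
auxiliary iterates `xt j`, the bundle sets `C j` (for `j ≥ 1`), and the best auxiliary serious
iterate `z j` found up to and including iteration `j`. -/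
structure Trace (n : ℕ) where
  x : ℕ → E n
  xc : ℕ → E n
  xt : ℕ → E n
  z : ℕ → E n
  C : ℕ → Finset (E n)

namespace Trace

variable {P : Inst} (T : Trace P.n) (lam δ : ℝ)

/-- The proximal term `‖u - x^c_{j-1}‖² / (2λ)`. -/
def prox (j : ℕ) (u : E P.n) : EReal := ((1 / (2 * lam) * ‖u - T.xc (j - 1)‖ ^ 2 : ℝ) : EReal)

/-- The objective `f_j + h + ‖· - x^c_{j-1}‖² / (2λ)` of the prox bundle subproblem. -/
def lowerObj (j : ℕ) (u : E P.n) : EReal :=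
  cutModel P (T.C j) u + P.h u + T.prox lam j u

/-- The function `φ_j^λ = φ + ‖· - x^c_{j-1}‖² / (2λ)`. -/
def upperObj (j : ℕ) (u : E P.n) : EReal := P.phi u + T.prox lam j u

/-- `t_j = φ_j^λ(x̃_j) - m_j`, where `m_j` is the optimal value of the `j`-th subproblem. -/
def gap (j : ℕ) : EReal := T.upperObj lam j (T.xt j) - T.lowerObj lam j (T.x j)

/-- Serious iteration indices; `0` is one by convention. -/
def Serious (j : ℕ) : Prop := j = 0 ∨ T.gap lam j ≤ (δ : EReal)

/-- `T` is a run of `RPB(x₀, λ, δ)` on the instance `P` (without a termination criterion). All the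
choices that the method leaves open (bundle sets, ties) are left open here. -/
structure IsRun : Prop where
  x_zero : T.x 0 = P.x0
  xc_zero : T.xc 0 = P.x0
  xt_zero : T.xt 0 = P.x0
  z_zero : T.z 0 = P.x0
  C_one : T.C 1 = {P.x0}
  /-- bundle sets consist of earlier iterates -/
  C_sub : ∀ j, 1 ≤ j → ∀ y ∈ T.C j, ∃ i < j, y = T.x i
  /-- `x_j` solves the prox bundle subproblem -/
  x_min : ∀ j, 1 ≤ j → ∀ u, T.lowerObj lam j (T.x j) ≤ T.lowerObj lam j u
  /-- `x̃_j` is the better of `x_j` and `x̃_{j-1}` with respect to `φ_j^λ` -/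
  xt_mem : ∀ j, 1 ≤ j → T.xt j = T.x j ∨ T.xt j = T.xt (j - 1)
  xt_le : ∀ j, 1 ≤ j → T.upperObj lam j (T.xt j) ≤ T.upperObj lam j (T.x j) ∧
    T.upperObj lam j (T.xt j) ≤ T.upperObj lam j (T.xt (j - 1))
  /-- `x_j` enters the bundle in both kinds of iterations -/
  C_mem : ∀ j, 1 ≤ j → T.x j ∈ T.C (j + 1)
  /-- serious iterations -/
  xc_serious : ∀ j, 1 ≤ j → T.Serious lam δ j → T.xc j = T.x j
  z_mem : ∀ j, 1 ≤ j → T.Serious lam δ j → T.z j = T.z (j - 1) ∨ T.z j = T.xt j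
  z_le : ∀ j, 1 ≤ j → T.Serious lam δ j →
    P.phi (T.z j) ≤ P.phi (T.z (j - 1)) ∧ P.phi (T.z j) ≤ P.phi (T.xt j)
  /-- null iterations -/
  xc_null : ∀ j, 1 ≤ j → ¬ T.Serious lam δ j → T.xc j = T.xc (j - 1)
  z_null : ∀ j, 1 ≤ j → ¬ T.Serious lam δ j → T.z j = T.z (j - 1)
  /-- the cuts that are active at `x_j` are kept -/
  C_active : ∀ j, 1 ≤ j → ¬ T.Serious lam δ j → ∀ y ∈ T.C j,
    P.f y + ((inner ℝ (P.f' y) (T.x j - y) : ℝ) : EReal) = cutModel P (T.C j) (T.x j) →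
      y ∈ T.C (j + 1)
  C_null : ∀ j, 1 ≤ j → ¬ T.Serious lam δ j → ∀ y ∈ T.C (j + 1), y ∈ T.C j ∨ y = T.x j

end Trace

/-- The algorithm that outputs the iterates of the given runs up to and including the first
iterate that is an `ε`-solution (if there is none, then the set below is empty, `J = 1`, and the
result is not in the class `algClass`). -/
def runAlgorithm (ε : ℝ) (T : (P : Inst) → Trace P.n) : Algorithm where
  J := fun P => sInf {j | P.IsSol ε ((T P).x j)} + 1
  x := fun P => (T P).x

/-- The function `min {M_f² R₀² / ε², (M_f² / (μ ε) + 1) log (μ R₀² / ε + 1)}`, where the second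
term is understood as the first one if `μ = 0`. -/
def rate (ε Mf R0 μ : ℝ) : ℝ :=
  if μ = 0 then Mf ^ 2 * R0 ^ 2 / ε ^ 2
  else min (Mf ^ 2 * R0 ^ 2 / ε ^ 2)
    ((Mf ^ 2 / (μ * ε) + 1) * Real.log (μ * R0 ^ 2 / ε + 1))

/-- `RPB(·, λ, ε/2)` is `ε`-optimal for `I` up to the factor `l`, with underlying constant `c`.
Namely: the method is well defined on `I`, and, for every choice of one run per instance of `I`,
the resulting algorithm is `ε`-optimal for `I` up to `l`, and on every instance of `I` the method
obtains a best auxiliary serious iterate that is an `ε`-solution after at most `c (r + 1)`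
iterations in total. -/
def RPBOptimal (c l r ε lam : ℝ) (I : Set Inst) : Prop :=
  (∀ P ∈ I, ∃ T : Trace P.n, T.IsRun lam (ε / 2)) ∧
  ∀ T : (P : Inst) → Trace P.n, (∀ P ∈ I, (T P).IsRun lam (ε / 2)) →
    IsOptimalUpTo c l I ε (runAlgorithm ε T) ∧
    ∀ P ∈ I, ∃ N : ℕ, (T P).Serious lam (ε / 2) N ∧ P.IsSol ε ((T P).z N) ∧
      (N : ℝ) ≤ c * (r + 1)

end CNCO

end

open CNCO

open CNCO

/-! The upper bound multiplies the length of a cycle (the iterations up to the next serious one) by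
the number of cycles. Write σ = 1/λ + μ. The subproblem is σ-strongly convex, and since active cuts
are kept, a null iteration raises its optimal value by at least σ/2 times the squared distance
between the two successive minimizers (`growth_of_active_cuts`). The cut at the previous iterate
bounds the gap by 2M_f times that same distance (`realGap_le`). Eliminating the distance gives t⁺ ≤
t - (t⁺)²/K with K = 8M_f²/σ, so a cycle has at most 2 + T₁/K + 2K/δ iterations, where T₁ bounds its
first gap.

With δ = ε/2, a serious iteration whose best candidate is not an ε-solution satisfies λε + (1 +
λμ)‖x_j - x*‖² ≤ ‖x^c_{j-1} - x*‖² (`dist_sq_contraction`). Iterating gives a geometric sum;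
ignoring μ in it yields the sublinear bound on the number of cycles, keeping μ the logarithmic one.
A cycle costs O(M_f²/(σε)), and λ essentially cancels in the product (`exists_serious_sol_le_rate`).
The two parts differ only in T₁: either λ ≥ R₀/M_f is long compared with the distance to a
minimizer, or h is Lipschitz.

The lower bound comes from γ max{x₁, …, xₙ, -ρ} + μ‖x‖²/2 started at 0 (`isClassLower_max`). Each
oracle answer reveals at most one new coordinate; while some coordinate is still zero the objective
is nonnegative, although its minimum lies below -ε. -/

namespace CNCO

/-! ### Strong convexity -/

section Convex

variable {F : Type*} [NormedAddCommGroup F] [InnerProductSpace ℝ F]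

/-- A strongly convex function grows quadratically away from a minimizer. -/
lemma growth_of_strongConvexOn {s : Set F} {m : ℝ} {g : F → ℝ} (hg : StrongConvexOn s m g)
    {x : F} (hx : x ∈ s) (hmin : ∀ u ∈ s, g x ≤ g u) {u : F} (hu : u ∈ s) :
    g x + m / 2 * ‖u - x‖ ^ 2 ≤ g u := by
  -- Compare x with (1 - α)x + αu, divide by α, then let α tend to 0.
  have key : ∀ α ∈ Set.Ioo (0 : ℝ) 1, g x + (1 - α) * (m / 2 * ‖u - x‖ ^ 2) ≤ g u := by
    rintro α ⟨h0, h1⟩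
    have h := hg.2 hx hu (by linarith : (0 : ℝ) ≤ 1 - α) h0.le (by ring)
    have h2 := hmin _ (hg.1 hx hu (by linarith : (0 : ℝ) ≤ 1 - α) h0.le (by ring))
    simp only [smul_eq_mul] at h
    rw [norm_sub_rev] at h
    have h3 : α * (g x + (1 - α) * (m / 2 * ‖u - x‖ ^ 2)) ≤ α * g u := by nlinarith
    exact le_of_mul_le_mul_left h3 h0
  have hlim : Filter.Tendsto (fun α : ℝ => g x + (1 - α) * (m / 2 * ‖u - x‖ ^ 2))
      (nhdsWithin 0 (Set.Ioi 0)) (nhds (g x + (1 - 0) * (m / 2 * ‖u - x‖ ^ 2))) := by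
    apply Filter.Tendsto.mono_left _ nhdsWithin_le_nhds
    exact (by fun_prop : Continuous fun α : ℝ =>
      g x + (1 - α) * (m / 2 * ‖u - x‖ ^ 2)).tendsto 0
  have := le_of_tendsto hlim (by
    filter_upwards [Ioo_mem_nhdsGT (zero_lt_one (α := ℝ))] with α hα using key α hα)
  simpa using this

lemma norm_sq_convex_combination (x y c : F) {a b : ℝ} (hab : a + b = 1) :
    ‖a • x + b • y - c‖ ^ 2 = a * ‖x - c‖ ^ 2 + b * ‖y - c‖ ^ 2 - a * b * ‖x - y‖ ^ 2 := by
  have h1 : a • x + b • y - c = a • (x - c) + b • (y - c) := by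
    have : c = (a + b) • c := by rw [hab, one_smul]
    nth_rewrite 1 [this]
    module
  have h2 : x - y = (x - c) - (y - c) := by abel
  rw [h1, h2, norm_add_sq_real, norm_sub_sq_real (x - c) (y - c), norm_smul, norm_smul,
    inner_smul_left, inner_smul_right, mul_pow, mul_pow, Real.norm_eq_abs, Real.norm_eq_abs, sq_abs, sq_abs]
  obtain rfl : b = 1 - a := by linarith
  simp only [conj_trivial]
  ring

/-- The identity for squared norms of convex combinations gives the prox term modulus exactly 1/λ,
and moduli add. -/
lemma strongConvexOn_add_prox {s : Set F} {μ lam : ℝ} {q h : F → ℝ} (hq : ConvexOn ℝ s q)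
    (hh : StrongConvexOn s μ h) (c : F) :
    StrongConvexOn s (1 / lam + μ) fun u => q u + h u + 1 / (2 * lam) * ‖u - c‖ ^ 2 := by
  refine ⟨hq.1, fun x hx y hy a b ha hb hab => ?_⟩
  have h1 := hq.2 hx hy ha hb hab
  have h2 := hh.2 hx hy ha hb hab
  simp only [smul_eq_mul] at h1 h2 ⊢
  rw [norm_sq_convex_combination x y c hab]
  have : 1 / (2 * lam) = 1 / lam / 2 := by ring
  rw [this]
  nlinarith

end Convex

/-! ### Real-valued forms of the data -/

namespace Inst

variable (P : Inst)

/-- The real value of `f`. -/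
noncomputable def fr (x : E P.n) : ℝ := (P.f x).toReal

/-- The real value of `h`. -/
noncomputable def hr (x : E P.n) : ℝ := (P.h x).toReal

/-- The linearization of `f` at `y`. -/
noncomputable def cut (y u : E P.n) : ℝ := P.fr y + inner ℝ (P.f' y) (u - y)

/-- The real value of the cutting-plane model. -/
noncomputable def model (S : Finset (E P.n)) (u : E P.n) : ℝ := (cutModel P S u).toReal

/-- The real value of the objective of the prox subproblem. -/
noncomputable def subObj (lam : ℝ) (S : Finset (E P.n)) (c u : E P.n) : ℝ :=
  P.model S u + P.hr u + 1 / (2 * lam) * ‖u - c‖ ^ 2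

/-- The real value of the proximal objective `φ + ‖· - c‖² / (2λ)`. -/
noncomputable def proxObj (lam : ℝ) (c u : E P.n) : ℝ :=
  P.fr u + P.hr u + 1 / (2 * lam) * ‖u - c‖ ^ 2

end Inst

/-! ### Cuts, cutting-plane models and growth of the subproblem -/

section Basic

variable {P : Inst} {μ Mf R0 lam : ℝ} {x y u : E P.n} {S S' : Finset (E P.n)}

lemma coe_hr (hP : P ∈ instClass μ Mf R0) (hx : x ∈ edom P.h) : P.h x = (P.hr x : EReal) :=
  (EReal.coe_toReal (ne_of_lt hx) (hP.2.1.2.1.1 x)).symm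

lemma coe_fr (hP : P ∈ instClass μ Mf R0) (hx : x ∈ edom P.h) : P.f x = (P.fr x : EReal) :=
  (EReal.coe_toReal (ne_of_lt (hP.2.1.2.2.1 hx)) (hP.2.1.1.1 x)).symm

lemma coe_phi (hP : P ∈ instClass μ Mf R0) (hx : x ∈ edom P.h) :
    P.phi x = ((P.fr x + P.hr x : ℝ) : EReal) := by
  rw [Inst.phi, coe_hr hP hx, coe_fr hP hx, EReal.coe_add]

lemma coe_cut (hP : P ∈ instClass μ Mf R0) (hy : y ∈ edom P.h) :
    P.f y + ((inner ℝ (P.f' y) (u - y) : ℝ) : EReal) = (P.cut y u : EReal) := by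
  rw [coe_fr hP hy, Inst.cut, EReal.coe_add]

lemma norm_subgrad_le (hP : P ∈ instClass μ Mf R0) (hx : x ∈ edom P.h) : ‖P.f' x‖ ≤ Mf :=
  hP.2.2.2.1.2 x hx

lemma cut_le (hP : P ∈ instClass μ Mf R0) (hx : x ∈ edom P.h) (hu : u ∈ edom P.h) :
    P.cut x u ≤ P.fr u := by
  have h := hP.2.1.2.2.2 x hx u
  rw [coe_cut hP hx, coe_fr hP hu] at h
  exact_mod_cast h

lemma abs_inner_subgrad_le (hP : P ∈ instClass μ Mf R0) (hx : x ∈ edom P.h) (v : E P.n) :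
    |inner ℝ (P.f' x) v| ≤ Mf * ‖v‖ :=
  (abs_real_inner_le_norm _ _).trans
    (mul_le_mul_of_nonneg_right (norm_subgrad_le hP hx) (norm_nonneg _))

/-- Linearizing at u as well bounds f(u) - f(x) by M_f‖u - x‖, and the slope at x costs another M_f;
hence the factor 2. -/
lemma fr_le_cut_add (hP : P ∈ instClass μ Mf R0) (hx : x ∈ edom P.h) (hu : u ∈ edom P.h) :
    P.fr u ≤ P.cut x u + 2 * Mf * ‖u - x‖ := by
  have h1 := cut_le hP hu hx
  have h2 := abs_le.1 (abs_inner_subgrad_le hP hx (u - x))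
  have h3 := abs_le.1 (abs_inner_subgrad_le hP hu (x - u))
  rw [norm_sub_rev x u] at h3
  simp only [Inst.cut] at *
  linarith

lemma coe_model (hP : P ∈ instClass μ Mf R0) (hS : S.Nonempty) (hSd : ∀ y ∈ S, y ∈ edom P.h) :
    cutModel P S u = (P.model S u : EReal) := by
  obtain ⟨y, hy, h⟩ := Finset.exists_mem_eq_sup S hS fun y =>
    P.f y + ((inner ℝ (P.f' y) (u - y) : ℝ) : EReal)
  have : cutModel P S u = (P.cut y u : EReal) := by rw [cutModel, h, coe_cut hP (hSd y hy)]
  rw [Inst.model, this, EReal.toReal_coe]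

lemma exists_cut_eq_model (hP : P ∈ instClass μ Mf R0) (hS : S.Nonempty)
    (hSd : ∀ y ∈ S, y ∈ edom P.h) (u : E P.n) : ∃ y ∈ S, P.model S u = P.cut y u := by
  obtain ⟨y, hy, h⟩ := Finset.exists_mem_eq_sup S hS fun y =>
    P.f y + ((inner ℝ (P.f' y) (u - y) : ℝ) : EReal)
  refine ⟨y, hy, ?_⟩
  have : cutModel P S u = (P.cut y u : EReal) := by rw [cutModel, h, coe_cut hP (hSd y hy)]
  rw [Inst.model, this, EReal.toReal_coe]

lemma cut_le_model (hP : P ∈ instClass μ Mf R0) (hSd : ∀ y ∈ S, y ∈ edom P.h) (hy : y ∈ S)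
    (u : E P.n) : P.cut y u ≤ P.model S u := by
  have h : P.f y + ((inner ℝ (P.f' y) (u - y) : ℝ) : EReal) ≤ cutModel P S u :=
    Finset.le_sup (f := fun y => P.f y + ((inner ℝ (P.f' y) (u - y) : ℝ) : EReal)) hy
  rw [coe_cut hP (hSd y hy), coe_model hP ⟨y, hy⟩ hSd] at h
  exact_mod_cast h

lemma model_le_fr (hP : P ∈ instClass μ Mf R0) (hS : S.Nonempty)
    (hSd : ∀ y ∈ S, y ∈ edom P.h) (hu : u ∈ edom P.h) : P.model S u ≤ P.fr u := by
  obtain ⟨y, hy, h⟩ := exists_cut_eq_model hP hS hSd u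
  rw [h]
  exact cut_le hP (hSd y hy) hu

lemma model_mono (hP : P ∈ instClass μ Mf R0) (hS : S.Nonempty)
    (hSd' : ∀ y ∈ S', y ∈ edom P.h) (hSS : S ⊆ S') (u : E P.n) : P.model S u ≤ P.model S' u := by
  obtain ⟨y, hy, h⟩ := exists_cut_eq_model hP hS (fun y hy => hSd' y (hSS hy)) u
  rw [h]
  exact cut_le_model hP hSd' (hSS hy) u

lemma strongConvexOn_hr (hP : P ∈ instClass μ Mf R0) : StrongConvexOn (edom P.h) μ P.hr := by
  have key : ∀ x ∈ edom P.h, ∀ y ∈ edom P.h, ∀ a b : ℝ, 0 ≤ a → 0 ≤ b → a + b = 1 →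
      P.h (a • x + b • y) ≤
        ((a * P.hr x + b * P.hr y - a * b * μ / 2 * ‖x - y‖ ^ 2 : ℝ) : EReal) := by
    intro x hx y hy a b ha hb hab
    obtain rfl : b = 1 - a := by linarith
    exact hP.2.2.2.1.1 x hx y hy a ha (by linarith)
  have hd : ∀ x ∈ edom P.h, ∀ y ∈ edom P.h, ∀ a b : ℝ, 0 ≤ a → 0 ≤ b → a + b = 1 →
      a • x + b • y ∈ edom P.h := fun x hx y hy a b ha hb hab =>
    (key x hx y hy a b ha hb hab).trans_lt (EReal.coe_lt_top _)
  refine ⟨fun x hx y hy a b ha hb hab => hd x hx y hy a b ha hb hab,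
    fun x hx y hy a b ha hb hab => ?_⟩
  have h := key x hx y hy a b ha hb hab
  rw [coe_hr hP (hd x hx y hy a b ha hb hab), EReal.coe_le_coe_iff] at h
  simp only [smul_eq_mul]
  linarith

lemma cut_convex_combination (y u v : E P.n) {a b : ℝ} (hab : a + b = 1) :
    P.cut y (a • u + b • v) = a * P.cut y u + b * P.cut y v := by
  have : a • u + b • v - y = a • (u - y) + b • (v - y) := by
    have : y = (a + b) • y := by rw [hab, one_smul]
    nth_rewrite 1 [this]
    module
  rw [Inst.cut, this, inner_add_right, inner_smul_right, inner_smul_right, Inst.cut, Inst.cut]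
  obtain rfl : b = 1 - a := by linarith
  ring

lemma convexOn_model (hP : P ∈ instClass μ Mf R0) (hS : S.Nonempty)
    (hSd : ∀ y ∈ S, y ∈ edom P.h) : ConvexOn ℝ (edom P.h) (P.model S) := by
  refine ⟨(strongConvexOn_hr hP).1, fun u _ v _ a b ha hb hab => ?_⟩
  obtain ⟨y, hy, h⟩ := exists_cut_eq_model hP hS hSd (a • u + b • v)
  rw [h, cut_convex_combination y u v hab]
  exact add_le_add (mul_le_mul_of_nonneg_left (cut_le_model hP hSd hy u) ha)
    (mul_le_mul_of_nonneg_left (cut_le_model hP hSd hy v) hb)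

lemma strongConvexOn_subObj (hP : P ∈ instClass μ Mf R0) (hS : S.Nonempty)
    (hSd : ∀ y ∈ S, y ∈ edom P.h) (c : E P.n) :
    StrongConvexOn (edom P.h) (1 / lam + μ) (P.subObj lam S c) :=
  strongConvexOn_add_prox (convexOn_model hP hS hSd) (strongConvexOn_hr hP) c

lemma continuous_cut (y : E P.n) : Continuous (P.cut y) := by
  unfold Inst.cut
  fun_prop

/-- Keeping only the cuts that are active at the minimizer of the subproblem preserves the
quadratic growth of its objective. -/
lemma growth_of_active_cuts (hP : P ∈ instClass μ Mf R0) (hlam : 0 < lam) (hμ : 0 ≤ μ)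
    (hS : S.Nonempty) (hSd : ∀ y ∈ S, y ∈ edom P.h) (hSd' : ∀ y ∈ S', y ∈ edom P.h)
    {c : E P.n} (hx : x ∈ edom P.h)
    (hmin : ∀ u ∈ edom P.h, P.subObj lam S c x ≤ P.subObj lam S c u)
    (hact : ∀ y ∈ S, P.cut y x = P.model S x → y ∈ S') (hu : u ∈ edom P.h) :
    P.subObj lam S c x + (1 / lam + μ) / 2 * ‖u - x‖ ^ 2 ≤ P.subObj lam S' c u := by
  classical
  set A := S.filter fun y => P.cut y x = P.model S x with hA
  have hAS : A ⊆ S := Finset.filter_subset _ _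
  obtain ⟨y₀, hy₀, hy₀x⟩ := exists_cut_eq_model hP hS hSd x
  have hy₀A : y₀ ∈ A := Finset.mem_filter.2 ⟨hy₀, hy₀x.symm⟩
  have hAn : A.Nonempty := ⟨y₀, hy₀A⟩
  have hAd : ∀ y ∈ A, y ∈ edom P.h := fun y hy => hSd y (hAS hy)
  have hAx : P.model A x = P.model S x :=
    le_antisymm (model_mono hP hAn hSd hAS x) (hy₀x ▸ cut_le_model hP hAd hy₀A x)
  have hsc := strongConvexOn_subObj (lam := lam) hP hAn hAd c
  -- Inactive cuts are strictly below an active one near x, so dropping them does not change the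
  -- model there. A local minimizer of the convex reduced objective is global, and the reduced
  -- bundle is contained in `S'`.
  have hloc : IsLocalMinOn (P.subObj lam A c) (edom P.h) x := by
    have hev : ∀ᶠ v in nhds x, ∀ y ∈ S, y ∉ A → P.cut y v < P.cut y₀ v := by
      rw [Filter.eventually_all_finset]
      intro y hy
      by_cases hyA : y ∈ A
      · simp [hyA]
      · have hlt : P.cut y x < P.cut y₀ x := by
          rw [← hy₀x]
          exact lt_of_le_of_ne (cut_le_model hP hSd hy x)
            fun h => hyA (Finset.mem_filter.2 ⟨hy, h⟩)
        filter_upwards [(continuous_cut y).continuousAt.eventually_lt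
          (continuous_cut y₀).continuousAt hlt] with v hv _ using hv
    filter_upwards [mem_nhdsWithin_of_mem_nhds hev, self_mem_nhdsWithin] with v hv hvd
    have h1 : P.model S v ≤ P.model A v := by
      obtain ⟨y, hy, h⟩ := exists_cut_eq_model hP hS hSd v
      by_cases hyA : y ∈ A
      · exact h ▸ cut_le_model hP hAd hyA v
      · exact h ▸ (hv y hy hyA).le.trans (cut_le_model hP hAd hy₀A v)
    have h2 := hmin v hvd
    simp only [Inst.subObj] at h2 ⊢
    linarith
  have hconv : ConvexOn ℝ (edom P.h) (P.subObj lam A c) := by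
    rw [← strongConvexOn_zero]
    exact hsc.mono (by positivity)
  have hglob := IsMinOn.of_isLocalMinOn_of_convexOn hx hloc hconv
  have h3 := growth_of_strongConvexOn hsc hx (fun v hv => hglob hv) hu
  have h4 := model_mono hP hAn hSd' (fun y hy => hact y (hAS hy) (Finset.mem_filter.1 hy).2) u
  simp only [Inst.subObj] at h3 ⊢
  linarith

/-! ### Solutions -/

lemma argmin_subset_edom (hP : P ∈ instClass μ Mf R0) (hx : x ∈ P.argmin) : x ∈ edom P.h := by
  have h := hx P.x0
  rw [coe_phi hP hP.1] at h
  have h2 : P.f x + P.h x < ⊤ := h.trans_lt (EReal.coe_lt_top _)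
  by_contra hc
  have : P.h x = ⊤ := not_lt_top_iff.1 hc
  rw [this, EReal.add_top_of_ne_bot (hP.2.1.1.1 x)] at h2
  exact lt_irrefl _ h2

lemma fr_add_hr_le_of_mem_argmin (hP : P ∈ instClass μ Mf R0) (hx : x ∈ P.argmin)
    (hu : u ∈ edom P.h) : P.fr x + P.hr x ≤ P.fr u + P.hr u := by
  have h := hx u
  rw [coe_phi hP (argmin_subset_edom hP hx), coe_phi hP hu] at h
  exact_mod_cast h

lemma phiStar_eq (hx : x ∈ P.argmin) : P.phiStar = P.phi x :=
  le_antisymm (iInf_le _ _) (le_iInf hx)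

lemma isSol_iff (hP : P ∈ instClass μ Mf R0) (hx : x ∈ P.argmin) (hu : u ∈ edom P.h) {ε : ℝ} :
    P.IsSol ε u ↔ P.fr u + P.hr u ≤ P.fr x + P.hr x + ε := by
  rw [Inst.IsSol, phiStar_eq hx, coe_phi hP hu, coe_phi hP (argmin_subset_edom hP hx),
    ← EReal.coe_add, EReal.coe_le_coe_iff]

end Basic

/-! ### Runs of the method -/

/-- The real value of the gap `t_{j+1}`. -/
noncomputable def Trace.realGap (P : Inst) (T : Trace P.n) (lam : ℝ) (j : ℕ) : ℝ :=
  P.proxObj lam (T.xc j) (T.xt (j + 1)) - P.subObj lam (T.C (j + 1)) (T.xc j) (T.x (j + 1))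

section Run

variable {P : Inst} {μ Mf R0 lam δ : ℝ} {T : Trace P.n} {x u : E P.n}

lemma lowerObj_eq (T : Trace P.n) (hP : P ∈ instClass μ Mf R0) (j : ℕ)
    (hn : (T.C (j + 1)).Nonempty) (hd : ∀ y ∈ T.C (j + 1), y ∈ edom P.h) (hu : u ∈ edom P.h) :
    T.lowerObj (P := P) lam (j + 1) u = (P.subObj lam (T.C (j + 1)) (T.xc j) u : EReal) := by
  rw [Trace.lowerObj, coe_model hP hn hd, coe_hr hP hu, Trace.prox, Nat.add_sub_cancel,
    Inst.subObj, EReal.coe_add, EReal.coe_add]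

lemma upperObj_eq (T : Trace P.n) (hP : P ∈ instClass μ Mf R0) (j : ℕ) (hu : u ∈ edom P.h) :
    T.upperObj (P := P) lam (j + 1) u = (P.proxObj lam (T.xc j) u : EReal) := by
  rw [Trace.upperObj, coe_phi hP hu, Trace.prox, Nat.add_sub_cancel, Inst.proxObj,
    EReal.coe_add (P.fr u + P.hr u)]

variable (hT : T.IsRun (P := P) lam δ)
include hT

lemma x_mem_C_succ (j : ℕ) : T.x j ∈ T.C (j + 1) := by
  rcases Nat.eq_zero_or_pos j with rfl | hj
  · rw [hT.x_zero, zero_add, hT.C_one]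
    exact Finset.mem_singleton_self _
  · exact hT.C_mem j hj

/-- Strong induction: earlier iterates in the domain make the model finite, so the subproblem has a
finite value at x₀, which its minimizer cannot exceed. -/
lemma x_mem_edom (hP : P ∈ instClass μ Mf R0) (j : ℕ) : T.x j ∈ edom P.h := by
  induction j using Nat.strong_induction_on with
  | _ j ih =>
    rcases j with _ | j
    · rw [hT.x_zero]
      exact hP.1
    · have hd : ∀ y ∈ T.C (j + 1), y ∈ edom P.h := by
        intro y hy
        obtain ⟨i, hi, rfl⟩ := hT.C_sub (j + 1) (by omega) y hy
        exact ih i hi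
      have hn : (T.C (j + 1)).Nonempty := ⟨_, x_mem_C_succ hT j⟩
      have h := hT.x_min (j + 1) (by omega) P.x0
      rw [lowerObj_eq T hP j hn hd hP.1] at h
      have h2 := h.trans_lt (EReal.coe_lt_top _)
      by_contra hc
      have hc' : P.h (T.x (j + 1)) = ⊤ := not_lt_top_iff.1 hc
      rw [Trace.lowerObj, coe_model hP hn hd, hc', EReal.coe_add_top, Trace.prox,
        EReal.top_add_coe] at h2
      exact lt_irrefl _ h2

lemma C_subset_edom (hP : P ∈ instClass μ Mf R0) (j : ℕ) : ∀ y ∈ T.C (j + 1), y ∈ edom P.h := by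
  intro y hy
  obtain ⟨i, _, rfl⟩ := hT.C_sub (j + 1) (by omega) y hy
  exact x_mem_edom hT hP i

lemma exists_xt_eq (j : ℕ) : ∃ i ≤ j, T.xt j = T.x i := by
  induction j with
  | zero => exact ⟨0, le_rfl, by rw [hT.xt_zero, hT.x_zero]⟩
  | succ j ih =>
    rcases hT.xt_mem (j + 1) (by omega) with h | h
    · exact ⟨j + 1, le_rfl, h⟩
    · obtain ⟨i, hi, h'⟩ := ih
      exact ⟨i, by omega, h.trans h'⟩

lemma exists_xc_eq (j : ℕ) : ∃ i ≤ j, T.xc j = T.x i := by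
  induction j with
  | zero => exact ⟨0, le_rfl, by rw [hT.xc_zero, hT.x_zero]⟩
  | succ j ih =>
    by_cases hs : T.Serious (P := P) lam δ (j + 1)
    · exact ⟨j + 1, le_rfl, hT.xc_serious _ (by omega) hs⟩
    · obtain ⟨i, hi, h'⟩ := ih
      exact ⟨i, by omega, (hT.xc_null _ (by omega) hs).trans h'⟩

/-- This transfers bounds on the best serious point to the sequence of iterates, which is what the
complexity `J` counts. -/
lemma exists_z_eq (j : ℕ) : ∃ i ≤ j, T.z j = T.x i := by
  induction j with
  | zero => exact ⟨0, le_rfl, by rw [hT.z_zero, hT.x_zero]⟩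
  | succ j ih =>
    obtain ⟨i, hi, h'⟩ := ih
    by_cases hs : T.Serious (P := P) lam δ (j + 1)
    · rcases hT.z_mem _ (by omega) hs with h | h
      · exact ⟨i, by omega, h.trans h'⟩
      · obtain ⟨i', hi', h''⟩ := exists_xt_eq hT (j + 1)
        exact ⟨i', hi', h.trans h''⟩
    · exact ⟨i, by omega, (hT.z_null _ (by omega) hs).trans h'⟩

lemma xt_mem_edom (hP : P ∈ instClass μ Mf R0) (j : ℕ) : T.xt j ∈ edom P.h := by
  obtain ⟨i, _, h⟩ := exists_xt_eq hT j
  exact h ▸ x_mem_edom hT hP i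

lemma xc_eq_of_serious {i : ℕ} (hi : T.Serious (P := P) lam δ i) : T.xc i = T.x i := by
  rcases Nat.eq_zero_or_pos i with rfl | hpos
  · rw [hT.xc_zero, hT.x_zero]
  · exact hT.xc_serious i hpos hi

lemma serious_succ_iff (hP : P ∈ instClass μ Mf R0) (j : ℕ) :
    T.Serious (P := P) lam δ (j + 1) ↔ T.realGap P lam j ≤ δ := by
  rw [Trace.Serious, Trace.gap, upperObj_eq T hP j (xt_mem_edom hT hP _),
    lowerObj_eq T hP j ⟨_, x_mem_C_succ hT j⟩ (C_subset_edom hT hP j) (x_mem_edom hT hP _),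
    ← EReal.coe_sub, EReal.coe_le_coe_iff, Trace.realGap]
  simp

lemma subObj_min (hP : P ∈ instClass μ Mf R0) (j : ℕ) (hu : u ∈ edom P.h) :
    P.subObj lam (T.C (j + 1)) (T.xc j) (T.x (j + 1)) ≤
      P.subObj lam (T.C (j + 1)) (T.xc j) u := by
  have h := hT.x_min (j + 1) (by omega) u
  have hn : (T.C (j + 1)).Nonempty := ⟨_, x_mem_C_succ hT j⟩
  rw [lowerObj_eq T hP j hn (C_subset_edom hT hP j) hu,
    lowerObj_eq T hP j hn (C_subset_edom hT hP j) (x_mem_edom hT hP _)] at h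
  exact_mod_cast h

lemma proxObj_xt_le (hP : P ∈ instClass μ Mf R0) (j : ℕ) :
    P.proxObj lam (T.xc j) (T.xt (j + 1)) ≤ P.proxObj lam (T.xc j) (T.x (j + 1)) ∧
      P.proxObj lam (T.xc j) (T.xt (j + 1)) ≤ P.proxObj lam (T.xc j) (T.xt j) := by
  have h := hT.xt_le (j + 1) (by omega)
  rw [upperObj_eq T hP j (xt_mem_edom hT hP _), upperObj_eq T hP j (x_mem_edom hT hP _),
    upperObj_eq T hP j (xt_mem_edom hT hP _)] at h
  exact_mod_cast h

/-- The subproblem value plus the quadratic growth is a lower bound of the proximal objective. -/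
lemma subObj_growth (hP : P ∈ instClass μ Mf R0) (j : ℕ) (hu : u ∈ edom P.h) :
    P.subObj lam (T.C (j + 1)) (T.xc j) (T.x (j + 1)) +
      (1 / lam + μ) / 2 * ‖u - T.x (j + 1)‖ ^ 2 ≤ P.proxObj lam (T.xc j) u := by
  have hn : (T.C (j + 1)).Nonempty := ⟨_, x_mem_C_succ hT j⟩
  have hd := C_subset_edom hT hP j
  have h1 := growth_of_strongConvexOn (strongConvexOn_subObj (lam := lam) hP hn hd (T.xc j))
    (x_mem_edom hT hP (j + 1)) (fun v hv => subObj_min hT hP j hv) hu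
  have h2 := model_le_fr hP hn hd hu
  simp only [Inst.subObj, Inst.proxObj] at h1 h2 ⊢
  linarith

/-- The model error at the new iterate is controlled by the distance to the previous one. -/
lemma proxObj_le_subObj_add (hP : P ∈ instClass μ Mf R0) (j : ℕ) :
    P.proxObj lam (T.xc j) (T.x (j + 1)) ≤
      P.subObj lam (T.C (j + 1)) (T.xc j) (T.x (j + 1)) + 2 * Mf * ‖T.x (j + 1) - T.x j‖ := by
  have h2 := fr_le_cut_add hP (x_mem_edom hT hP j) (x_mem_edom hT hP (j + 1))
  have h3 := cut_le_model hP (C_subset_edom hT hP j) (x_mem_C_succ hT j) (T.x (j + 1))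
  simp only [Inst.subObj, Inst.proxObj]
  linarith

/-- The bundle contains the previous iterate, so its cut alone controls the model error at the new
one. -/
lemma realGap_le (hP : P ∈ instClass μ Mf R0) (j : ℕ) :
    T.realGap P lam j ≤ 2 * Mf * ‖T.x (j + 1) - T.x j‖ := by
  have h1 := (proxObj_xt_le hT hP j).1
  have h2 := proxObj_le_subObj_add hT hP j
  rw [Trace.realGap]
  linarith

/-- The hypothesis says that iteration j + 1 is null. The center then stays, the auxiliary iterate
can only improve, and the subproblem value rises by the growth term. -/
lemma realGap_succ_le (hP : P ∈ instClass μ Mf R0) (hlam : 0 < lam) (hμ : 0 ≤ μ) {j : ℕ}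
    (hj : δ < T.realGap P lam j) :
    T.realGap P lam (j + 1) ≤
      T.realGap P lam j - (1 / lam + μ) / 2 * ‖T.x (j + 2) - T.x (j + 1)‖ ^ 2 := by
  have hns : ¬ T.Serious (P := P) lam δ (j + 1) := fun h =>
    absurd ((serious_succ_iff hT hP j).1 h) (not_le.2 hj)
  have hxc : T.xc (j + 1) = T.xc j := hT.xc_null (j + 1) (by omega) hns
  have hn : (T.C (j + 1)).Nonempty := ⟨_, x_mem_C_succ hT j⟩
  have hd := C_subset_edom hT hP j
  have h1 := (proxObj_xt_le hT hP (j + 1)).2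
  have h2 := growth_of_active_cuts hP hlam hμ hn hd (C_subset_edom hT hP (j + 1))
    (x_mem_edom hT hP (j + 1)) (fun v hv => subObj_min hT hP j hv)
    (fun y hy hyx => hT.C_active (j + 1) (by omega) hns y hy (by
      rw [coe_cut hP (hd y hy), coe_model hP hn hd, hyx])) (x_mem_edom hT hP (j + 2))
  rw [hxc] at h1
  rw [Trace.realGap, Trace.realGap, hxc]
  linarith

/-- The step length is at least t/(2M_f), so the growth term is at least (σ/2)(t/(2M_f))² = t²/K
with K = 8M_f²/σ, where σ = 1/λ + μ. -/
lemma realGap_succ_le_sq (hP : P ∈ instClass μ Mf R0) (hlam : 0 < lam) (hμ : 0 ≤ μ)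
    (hMf : 0 < Mf) (hδ : 0 < δ) {j : ℕ}
    (hj : δ < T.realGap P lam j) (hj' : δ < T.realGap P lam (j + 1)) :
    T.realGap P lam (j + 1) ≤ T.realGap P lam j -
      T.realGap P lam (j + 1) ^ 2 / (8 * Mf ^ 2 / (1 / lam + μ)) := by
  have h1 := realGap_succ_le hT hP hlam hμ hj
  have h2 := realGap_le hT hP (j + 1)
  have hσ : 0 < 1 / lam + μ := by positivity
  have h3 : T.realGap P lam (j + 1) ^ 2 ≤ (2 * Mf * ‖T.x (j + 2) - T.x (j + 1)‖) ^ 2 :=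
    pow_le_pow_left₀ (hδ.le.trans hj'.le) h2 2
  have h4 : T.realGap P lam (j + 1) ^ 2 / (8 * Mf ^ 2 / (1 / lam + μ)) ≤
      (1 / lam + μ) / 2 * ‖T.x (j + 2) - T.x (j + 1)‖ ^ 2 := by
    rw [div_le_iff₀ (by positivity)]
    refine h3.trans (le_of_eq ?_)
    field_simp
    ring
  linarith

end Run

/-! ### Length of a cycle -/

/-- Both summands of the potential s/K - 2K/s are monotone. For b ≥ K the linear one drops by b²/K²
≥ 1. For b ≤ K the reciprocal one drops by at least 2K/(K + b) ≥ 1. -/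
lemma potential_decrease {K a b : ℝ} (hK : 0 < K) (hb : 0 < b) (h : b ≤ a - b ^ 2 / K) :
    b / K - 2 * K / b + 1 ≤ a / K - 2 * K / a := by
  have hab : b + b ^ 2 / K ≤ a := by linarith
  have hba : b ≤ a := le_trans (by have : 0 ≤ b ^ 2 / K := by positivity
                                   linarith) hab
  have ha : 0 < a := hb.trans_le hba
  rcases le_total K b with hKb | hbK
  · have h1 : b / K + 1 ≤ a / K := by
      rw [div_add_one hK.ne']
      refine div_le_div_of_nonneg_right (le_trans ?_ hab) hK.le
      have : K ≤ b ^ 2 / K := by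
        rw [le_div_iff₀ hK]
        nlinarith
      linarith
    have h2 : 2 * K / a ≤ 2 * K / b := div_le_div_of_nonneg_left (by positivity) hb hba
    linarith
  · have h1 : b / K ≤ a / K := div_le_div_of_nonneg_right hba hK.le
    have h2 : 2 * K / a + 1 ≤ 2 * K / b := by
      rw [div_add_one ha.ne', div_le_div_iff₀ ha hb]
      have h3 : b * K + b ^ 2 ≤ a * K := by
        have := mul_le_mul_of_nonneg_right hab hK.le
        rwa [add_mul, div_mul_cancel₀ _ hK.ne'] at this
      have h4 : (b * K + b ^ 2) * (2 * K - b) ≤ a * K * (2 * K - b) :=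
        mul_le_mul_of_nonneg_right h3 (by linarith)
      have h5 : 0 ≤ b ^ 2 * (K - b) := mul_nonneg (sq_nonneg _) (by linarith)
      have h6 : K * ((2 * K + a) * b) ≤ K * (2 * K * a) := by nlinarith
      exact le_of_mul_le_mul_left h6 hK
    linarith

/-- A sequence that decreases by at least `s_{k+1}² / K` while it exceeds `δ` drops below `δ`
after at most `1 + T₁ / K + 2 K / δ` steps. -/
lemma exists_le_of_sq_decrease {s : ℕ → ℝ} {K δ T₁ : ℝ} (hK : 0 < K) (hδ : 0 < δ) (hT₁ : 0 ≤ T₁)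
    (h0 : s 0 ≤ T₁)
    (hs : ∀ k, δ < s k → δ < s (k + 1) → s (k + 1) ≤ s k - s (k + 1) ^ 2 / K) :
    ∃ m : ℕ, (∀ k < m, δ < s k) ∧ s m ≤ δ ∧ (m : ℝ) ≤ 1 + T₁ / K + 2 * K / δ := by
  have key : ∀ n : ℕ, (∀ k ≤ n, δ < s k) → s n / K - 2 * K / s n + n ≤ s 0 / K - 2 * K / s 0 := by
    intro n
    induction n with
    | zero => intro _; simp
    | succ n ih =>
      intro h
      have h1 := ih fun k hk => h k (by omega)
      have h2 := potential_decrease hK (hδ.trans (h (n + 1) le_rfl))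
        (hs n (h n (by omega)) (h (n + 1) le_rfl))
      push_cast
      linarith
  have bound : ∀ n : ℕ, (∀ k ≤ n, δ < s k) → (n : ℝ) ≤ T₁ / K + 2 * K / δ := by
    intro n h
    have h1 := key n h
    have hn := h n le_rfl
    have hz := h 0 (by omega)
    have h2 : 0 ≤ s n / K := div_nonneg (hδ.trans hn).le hK.le
    have h3 : 2 * K / s n ≤ 2 * K / δ := div_le_div_of_nonneg_left (by positivity) hδ hn.le
    have h4 : s 0 / K ≤ T₁ / K := div_le_div_of_nonneg_right h0 hK.le
    have h5 : 0 ≤ 2 * K / s 0 := div_nonneg (by positivity) (hδ.trans hz).le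
    linarith
  have hex : ∃ m, s m ≤ δ := by
    by_contra! hc
    have := bound (⌊T₁ / K + 2 * K / δ⌋₊ + 1) fun k _ => hc k
    have h2 := Nat.lt_floor_add_one (T₁ / K + 2 * K / δ)
    push_cast at this
    linarith
  classical
  refine ⟨Nat.find hex, fun k hk => not_le.1 (Nat.find_min hex hk), Nat.find_spec hex, ?_⟩
  rcases h : Nat.find hex with _ | n
  · have : 0 ≤ T₁ / K := by positivity
    have : 0 ≤ 2 * K / δ := by positivity
    push_cast
    linarith
  · have := bound n fun k hk => not_le.1 (Nat.find_min hex (by omega))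
    push_cast
    linarith

/-! ### From cycle length to the number of serious iterations -/

section Run

variable {P : Inst} {μ Mf R0 lam δ : ℝ} {T : Trace P.n}

/-- Gap i + k belongs to iteration i + k + 1; this shift turns the 1 of the scalar estimate into 2.
-/
lemma exists_next_serious (hT : T.IsRun (P := P) lam δ) (hP : P ∈ instClass μ Mf R0)
    (hlam : 0 < lam) (hμ : 0 ≤ μ) (hMf : 0 < Mf) (hδ : 0 < δ) {T₁ : ℝ} (hT₁ : 0 ≤ T₁) {i : ℕ}
    (hi : T.realGap P lam i ≤ T₁) :
    ∃ m : ℕ, T.Serious (P := P) lam δ (i + m + 1) ∧ T.xc (i + m) = T.xc i ∧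
      ((i + m + 1 : ℕ) : ℝ) ≤
        i + (2 + T₁ / (8 * Mf ^ 2 / (1 / lam + μ)) + 2 * (8 * Mf ^ 2 / (1 / lam + μ)) / δ) := by
  obtain ⟨m, h1, h2, h3⟩ := exists_le_of_sq_decrease (s := fun k => T.realGap P lam (i + k))
    (K := 8 * Mf ^ 2 / (1 / lam + μ)) (by positivity) hδ hT₁ hi
    (fun k hk hk' => realGap_succ_le_sq hT hP hlam hμ hMf hδ hk hk')
  refine ⟨m, (serious_succ_iff hT hP _).2 h2, ?_, ?_⟩
  · have : ∀ k ≤ m, T.xc (i + k) = T.xc i := by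
      intro k
      induction k with
      | zero => intro _; rfl
      | succ k ih =>
        intro hk
        have h4 : ¬ T.Serious (P := P) lam δ (i + k + 1) := fun h =>
          absurd ((serious_succ_iff hT hP _).1 h) (not_le.2 (h1 k (by omega)))
        exact (hT.xc_null (i + k + 1) (by omega) h4).trans (ih (by omega))
    exact this m le_rfl
  · push_cast
    linarith

/-- Contraction of the squared distance to a minimizer at a serious iteration that does not
produce a `2δ`-solution. -/
lemma dist_sq_contraction (hT : T.IsRun (P := P) lam δ) (hP : P ∈ instClass μ Mf R0)
    (hlam : 0 < lam) {j : ℕ} (hj : T.Serious (P := P) lam δ (j + 1)) {xs : E P.n}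
    (hxs : xs ∈ P.argmin) (hns : ¬ P.IsSol (2 * δ) (T.xt (j + 1))) :
    lam * (2 * δ) + (1 + lam * μ) * ‖T.x (j + 1) - xs‖ ^ 2 ≤ ‖T.xc j - xs‖ ^ 2 := by
  have h1 := (serious_succ_iff hT hP j).1 hj
  rw [isSol_iff hP hxs (xt_mem_edom hT hP _), not_le] at hns
  have h2 := subObj_growth hT hP j (argmin_subset_edom hP hxs)
  rw [Trace.realGap] at h1
  have h3 : 0 ≤ 1 / (2 * lam) * ‖T.xt (j + 1) - T.xc j‖ ^ 2 := by positivity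
  rw [norm_sub_rev] at h2
  simp only [Inst.proxObj] at h1 h2
  rw [norm_sub_rev xs] at h2
  -- The candidate exceeds the optimal value by more than 2δ, and the serious test gives back at
  -- most δ, so one δ remains.
  have h4 : δ + (1 / lam + μ) / 2 * ‖T.x (j + 1) - xs‖ ^ 2 ≤
      1 / (2 * lam) * ‖T.xc j - xs‖ ^ 2 := by linarith
  have h5 := mul_le_mul_of_nonneg_left h4 (by positivity : 0 ≤ 2 * lam)
  have e1 : 2 * lam * (δ + (1 / lam + μ) / 2 * ‖T.x (j + 1) - xs‖ ^ 2) =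
      lam * (2 * δ) + (1 + lam * μ) * ‖T.x (j + 1) - xs‖ ^ 2 := by
    field_simp
  have e2 : 2 * lam * (1 / (2 * lam) * ‖T.xc j - xs‖ ^ 2) = ‖T.xc j - xs‖ ^ 2 := by
    field_simp
  rwa [e1, e2] at h5

/-- The outer complexity estimate: if every cycle starting close to `xs` has length at most `L`,
then an `2δ`-solution is obtained within `k L` iterations once the accumulated decrease exceeds
the initial squared distance. -/
lemma exists_serious_sol (hT : T.IsRun (P := P) lam δ) (hP : P ∈ instClass μ Mf R0)
    (hlam : 0 < lam) (hμ : 0 ≤ μ) (hMf : 0 < Mf) (hδ : 0 < δ) {T₁ L : ℝ} (hT₁ : 0 ≤ T₁)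
    {xs : E P.n} (hxs : xs ∈ P.argmin)
    (hcyc : ∀ i, T.Serious (P := P) lam δ i → ‖T.xc i - xs‖ ≤ ‖P.x0 - xs‖ →
      T.realGap P lam i ≤ T₁)
    (hL : L = 2 + T₁ / (8 * Mf ^ 2 / (1 / lam + μ)) + 2 * (8 * Mf ^ 2 / (1 / lam + μ)) / δ)
    {k : ℕ}
    (hk : ‖P.x0 - xs‖ ^ 2 < lam * (2 * δ) * ∑ l ∈ Finset.range k, (1 + lam * μ) ^ l) :
    ∃ N : ℕ, T.Serious (P := P) lam δ N ∧ P.IsSol (2 * δ) (T.z N) ∧ (N : ℝ) ≤ k * L := by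
  have hq : 1 ≤ 1 + lam * μ := by
    have := mul_nonneg hlam.le hμ
    linarith
  have hL0 : 0 ≤ L := by rw [hL]; positivity
  -- After k cycles either a solution has been found, or the contractions, weighted by powers of 1 +
  -- λμ, have accumulated.
  have key : ∀ k : ℕ,
      (∃ N : ℕ, T.Serious (P := P) lam δ N ∧ P.IsSol (2 * δ) (T.z N) ∧ (N : ℝ) ≤ k * L) ∨
      ∃ i : ℕ, T.Serious (P := P) lam δ i ∧ (i : ℝ) ≤ k * L ∧
        lam * (2 * δ) * ∑ l ∈ Finset.range k, (1 + lam * μ) ^ l +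
          (1 + lam * μ) ^ k * ‖T.xc i - xs‖ ^ 2 ≤ ‖P.x0 - xs‖ ^ 2 := by
    intro k
    induction k with
    | zero => exact Or.inr ⟨0, Or.inl rfl, by simp, by simp [hT.xc_zero]⟩
    | succ k ih =>
      rcases ih with ⟨N, h1, h2, h3⟩ | ⟨i, hi, hik, hd⟩
      · refine Or.inl ⟨N, h1, h2, h3.trans ?_⟩
        push_cast
        linarith
      · have hpow : 1 ≤ (1 + lam * μ) ^ k := one_le_pow₀ hq
        have hsum : 0 ≤ lam * (2 * δ) * ∑ l ∈ Finset.range k, (1 + lam * μ) ^ l := by positivity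
        -- Centers never move farther from `xs` than x₀, so the first-gap hypothesis applies to
        -- every cycle.
        have hdist : ‖T.xc i - xs‖ ≤ ‖P.x0 - xs‖ := by
          refine le_of_sq_le_sq ?_ (norm_nonneg _)
          have := mul_le_mul_of_nonneg_right hpow (sq_nonneg ‖T.xc i - xs‖)
          linarith
        obtain ⟨m, hm1, hm2, hm3⟩ :=
          exists_next_serious hT hP hlam hμ hMf hδ hT₁ (hcyc i hi hdist)
        rw [← hL] at hm3
        have hm4 : ((i + m + 1 : ℕ) : ℝ) ≤ (k + 1 : ℕ) * L := by
          rw [Nat.cast_succ k, add_mul, one_mul]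
          linarith
        by_cases hsol : P.IsSol (2 * δ) (T.z (i + m + 1))
        · exact Or.inl ⟨_, hm1, hsol, hm4⟩
        · refine Or.inr ⟨_, hm1, hm4, ?_⟩
          have hns : ¬ P.IsSol (2 * δ) (T.xt (i + m + 1)) := fun h =>
            hsol ((hT.z_le _ (by omega) hm1).2.trans h)
          have h5 := dist_sq_contraction hT hP hlam hm1 hxs hns
          rw [hm2] at h5
          rw [xc_eq_of_serious hT hm1, Finset.sum_range_succ, pow_succ]
          have h6 := mul_le_mul_of_nonneg_left h5 (by linarith : 0 ≤ (1 + lam * μ) ^ k)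
          nlinarith
  rcases key k with h | ⟨i, _, _, h⟩
  · exact h
  · have : 0 ≤ (1 + lam * μ) ^ k * ‖T.xc i - xs‖ ^ 2 := by positivity
    linarith

/-! ### The first gap of a cycle -/

/-- Comparing the subproblem value with the proximal objective at `xs`, where φ is minimal, gives D²
≤ 4aD + 4a² for the first step length D and a = λM_f. The 6 used below rounds up the root 2 + 2√2.
-/
lemma realGap_le_of_serious (hT : T.IsRun (P := P) lam δ) (hP : P ∈ instClass μ Mf R0)
    (hlam : 0 < lam) (hμ : 0 ≤ μ) (hMf : 0 < Mf) {i : ℕ} (hi : T.Serious (P := P) lam δ i)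
    {xs : E P.n} (hxs : xs ∈ P.argmin) (hd : ‖T.xc i - xs‖ ≤ 2 * (lam * Mf)) :
    T.realGap P lam i ≤ 12 * lam * Mf ^ 2 := by
  have hxc := xc_eq_of_serious hT hi
  have h1 := subObj_growth hT hP i (argmin_subset_edom hP hxs)
  have h2 := proxObj_le_subObj_add hT hP i
  have h3 := fr_add_hr_le_of_mem_argmin hP hxs (x_mem_edom hT hP (i + 1))
  have h4 : 0 ≤ (1 / lam + μ) / 2 * ‖xs - T.x (i + 1)‖ ^ 2 := by positivity
  have h5 := realGap_le hT hP i
  simp only [Inst.proxObj] at h1 h2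
  rw [hxc] at hd
  rw [hxc, norm_sub_rev xs (T.x i)] at h1
  rw [hxc] at h2
  set D := ‖T.x (i + 1) - T.x i‖ with hD
  have hD0 : 0 ≤ D := norm_nonneg _
  have ha : 0 < lam * Mf := mul_pos hlam hMf
  have h6 : 1 / (2 * lam) * D ^ 2 ≤ 2 * Mf * D + 1 / (2 * lam) * ‖T.x i - xs‖ ^ 2 := by
    linarith
  have h7 : D ^ 2 ≤ 4 * (lam * Mf) * D + ‖T.x i - xs‖ ^ 2 := by
    have := mul_le_mul_of_nonneg_left h6 (by positivity : 0 ≤ 2 * lam)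
    have e1 : 2 * lam * (1 / (2 * lam) * D ^ 2) = D ^ 2 := by field_simp
    have e2 : 2 * lam * (2 * Mf * D + 1 / (2 * lam) * ‖T.x i - xs‖ ^ 2) =
      4 * (lam * Mf) * D + ‖T.x i - xs‖ ^ 2 := by
      field_simp
      ring
    rwa [e1, e2] at this
  have h8 : ‖T.x i - xs‖ ^ 2 ≤ (2 * (lam * Mf)) ^ 2 := pow_le_pow_left₀ (norm_nonneg _) hd 2
  have h9 : D ≤ 6 * (lam * Mf) := by
    by_contra! hc
    nlinarith
  calc T.realGap P lam i ≤ 2 * Mf * D := h5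
    _ ≤ 2 * Mf * (6 * (lam * Mf)) := mul_le_mul_of_nonneg_left h9 (by positivity)
    _ = 12 * lam * Mf ^ 2 := by ring

/-- Here the comparison point is the center itself: its own cut and the Lipschitz bound on h give
D²/(2λ) ≤ (1 + C)M_f D, with no reference to a minimizer. -/
lemma realGap_le_of_lipschitz (hT : T.IsRun (P := P) lam δ) (hP : P ∈ instClass μ Mf R0)
    (hlam : 0 < lam) (hμ : 0 ≤ μ) (hMf : 0 < Mf) {C Mh : ℝ} (hMh : Mh ≤ C * Mf) (h4 : P.A4 Mh)
    {i : ℕ} (hi : T.Serious (P := P) lam δ i) (hC : 0 < C) :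
    T.realGap P lam i ≤ 4 * (1 + C) * lam * Mf ^ 2 := by
  have hxc := xc_eq_of_serious hT hi
  have h1 := subObj_growth hT hP i (x_mem_edom hT hP i)
  have h2 := cut_le_model hP (C_subset_edom hT hP i) (x_mem_C_succ hT i) (T.x (i + 1))
  have h3 := (abs_le.1 (abs_inner_subgrad_le hP (x_mem_edom hT hP i) (T.x (i + 1) - T.x i))).1
  have h5 := realGap_le hT hP i
  have h6 := (abs_le.1 (h4 _ (x_mem_edom hT hP (i + 1)) _ (x_mem_edom hT hP i))).1
  simp only [Inst.proxObj, Inst.subObj, Inst.cut] at h1 h2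
  rw [hxc, sub_self, norm_zero, norm_sub_rev (T.x i)] at h1
  set D := ‖T.x (i + 1) - T.x i‖ with hD
  have hD0 : 0 ≤ D := norm_nonneg _
  have h7 : 0 ≤ (1 / lam + μ) / 2 * D ^ 2 := by positivity
  have h8 : -(Mh * D) ≤ P.hr (T.x (i + 1)) - P.hr (T.x i) := h6
  have h9 : Mh * D ≤ C * Mf * D := mul_le_mul_of_nonneg_right hMh hD0
  have h10 : 1 / (2 * lam) * D ^ 2 ≤ (1 + C) * Mf * D := by nlinarith
  have h11 : D ^ 2 ≤ 2 * lam * ((1 + C) * Mf * D) := by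
    have := mul_le_mul_of_nonneg_left h10 (by positivity : 0 ≤ 2 * lam)
    have e1 : 2 * lam * (1 / (2 * lam) * D ^ 2) = D ^ 2 := by field_simp
    rwa [e1] at this
  have h12 : D ≤ 2 * lam * ((1 + C) * Mf) := by
    rcases hD0.eq_or_lt with h | h
    · rw [← h]; positivity
    · refine le_of_mul_le_mul_right ?_ h
      nlinarith
  calc T.realGap P lam i ≤ 2 * Mf * D := h5
    _ ≤ 2 * Mf * (2 * lam * ((1 + C) * Mf)) := mul_le_mul_of_nonneg_left h12 (by positivity)
    _ = 4 * (1 + C) * lam * Mf ^ 2 := by ring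

end Run

/-! ### Existence of runs -/

/-- The objective of the prox subproblem with bundle `S` and center `c`. -/
noncomputable def bundleObj (P : Inst) (lam : ℝ) (S : Finset (E P.n)) (c u : E P.n) : EReal :=
  cutModel P S u + P.h u + ((1 / (2 * lam) * ‖u - c‖ ^ 2 : ℝ) : EReal)

section Exist

variable {P : Inst} {μ Mf R0 lam : ℝ} {S : Finset (E P.n)} {c x u : E P.n}

lemma coe_bundleObj (hP : P ∈ instClass μ Mf R0) (hS : S.Nonempty)
    (hSd : ∀ y ∈ S, y ∈ edom P.h) (hu : u ∈ edom P.h) :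
    bundleObj P lam S c u = (P.subObj lam S c u : EReal) := by
  rw [bundleObj, coe_model hP hS hSd, coe_hr hP hu, Inst.subObj, EReal.coe_add, EReal.coe_add]

lemma bundleObj_eq_top (hP : P ∈ instClass μ Mf R0) (hS : S.Nonempty)
    (hSd : ∀ y ∈ S, y ∈ edom P.h) (hu : u ∉ edom P.h) : bundleObj P lam S c u = ⊤ := by
  have : P.h u = ⊤ := not_lt_top_iff.1 hu
  rw [bundleObj, coe_model hP hS hSd, this, EReal.coe_add_top, EReal.top_add_coe]

lemma mem_edom_of_bundleObj_min (hP : P ∈ instClass μ Mf R0) (hS : S.Nonempty)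
    (hSd : ∀ y ∈ S, y ∈ edom P.h) (hx : ∀ u, bundleObj P lam S c x ≤ bundleObj P lam S c u) :
    x ∈ edom P.h := by
  by_contra hc
  have h := hx P.x0
  rw [bundleObj_eq_top hP hS hSd hc, coe_bundleObj hP hS hSd hP.1] at h
  exact absurd h (not_le.2 (EReal.coe_lt_top _))

/-- The model is a finite maximum of real affine functions, so it never meets the discontinuities of
addition in `EReal`. -/
lemma lowerSemicontinuous_bundleObj (hP : P ∈ instClass μ Mf R0) (hS : S.Nonempty)
    (hSd : ∀ y ∈ S, y ∈ edom P.h) : LowerSemicontinuous (bundleObj P lam S c) := by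
  have h1 : Continuous (cutModel P S) := by
    refine Continuous.finset_sup_apply fun y hy => ?_
    simp_rw [coe_cut hP (hSd y hy)]
    exact continuous_coe_real_ereal.comp (continuous_cut y)
  have h2 : LowerSemicontinuous fun u => cutModel P S u + P.h u := by
    refine h1.lowerSemicontinuous.add' hP.2.1.2.1.2.2.1 fun u => EReal.continuousAt_add ?_ ?_
    · rw [coe_model hP hS hSd]
      exact Or.inl (EReal.coe_ne_top _)
    · rw [coe_model hP hS hSd]
      exact Or.inl (EReal.coe_ne_bot _)
  have h3 : Continuous fun u : E P.n => ((1 / (2 * lam) * ‖u - c‖ ^ 2 : ℝ) : EReal) :=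
    continuous_coe_real_ereal.comp (by fun_prop)
  exact h2.add' h3.lowerSemicontinuous fun u =>
    EReal.continuousAt_add (Or.inr (EReal.coe_ne_bot _)) (Or.inr (EReal.coe_ne_top _))

/-- Since φ is bounded below, the cut at y keeps model plus h above φ* - 2M_f‖u - y‖. The prox term
dominates this linear loss outside a ball, and lower semicontinuity provides a minimizer inside. -/
lemma exists_bundleObj_min (hP : P ∈ instClass μ Mf R0) (hlam : 0 < lam) (hS : S.Nonempty)
    (hSd : ∀ y ∈ S, y ∈ edom P.h) (c : E P.n) :
    ∃ x, ∀ u, bundleObj P lam S c x ≤ bundleObj P lam S c u := by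
  obtain ⟨y, hy⟩ := hS
  obtain ⟨xs, hxs⟩ := hP.2.2.1
  have hyd := hSd y hy
  have hMf : 0 ≤ Mf := (norm_nonneg _).trans (norm_subgrad_le hP hyd)
  set b := ‖y - c‖ with hb
  have hb0 : 0 ≤ b := norm_nonneg _
  set w := P.subObj lam S c y - (P.fr xs + P.hr xs) + 2 * Mf * b with hw
  -- Outside this radius ‖u - c‖ ≥ 1 and the prox term exceeds (2M_f + |w| + 1)‖u - c‖; the summand
  -- b keeps y inside.
  set ρ := 1 + b + 2 * lam * (2 * Mf + |w| + 1) with hρ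
  have hp : 0 ≤ 2 * lam * (2 * Mf + |w| + 1) := by positivity
  have hyball : y ∈ Metric.closedBall c ρ := by
    rw [Metric.mem_closedBall, dist_eq_norm]
    linarith
  obtain ⟨x, hx, hmin⟩ := ((lowerSemicontinuous_bundleObj (lam := lam) (c := c) hP ⟨y, hy⟩
    hSd).lowerSemicontinuousOn _).exists_isMinOn ⟨y, hyball⟩ (isCompact_closedBall c ρ)
  refine ⟨x, fun u => ?_⟩
  by_cases hu : u ∈ Metric.closedBall c ρ
  · exact hmin hu
  by_cases hud : u ∈ edom P.h
  · refine (hmin hyball).trans ?_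
    rw [coe_bundleObj hP ⟨y, hy⟩ hSd hyd, coe_bundleObj hP ⟨y, hy⟩ hSd hud, EReal.coe_le_coe_iff]
    rw [Metric.mem_closedBall, dist_eq_norm, not_le] at hu
    have h1 := fr_le_cut_add hP hyd hud
    have h2 := cut_le_model hP hSd hy u
    have h3 := fr_add_hr_le_of_mem_argmin hP hxs hud
    have h4 : ‖u - y‖ ≤ ‖u - c‖ + b := by
      have : u - y = (u - c) - (y - c) := by abel
      rw [this]
      exact norm_sub_le _ _
    have h5 : 2 * Mf * ‖u - y‖ ≤ 2 * Mf * (‖u - c‖ + b) :=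
      mul_le_mul_of_nonneg_left h4 (by positivity)
    have h6 : 2 * Mf * ‖u - c‖ + |w| ≤ 1 / (2 * lam) * ‖u - c‖ ^ 2 := by
      have h7 : 2 * Mf + |w| + 1 ≤ 1 / (2 * lam) * ‖u - c‖ := by
        rw [one_div, inv_mul_eq_div, le_div_iff₀ (by positivity)]
        linarith
      have h8 : 1 ≤ ‖u - c‖ := by linarith
      have h9 := mul_le_mul_of_nonneg_right h7 (norm_nonneg (u - c))
      have h10 : |w| ≤ |w| * ‖u - c‖ := le_mul_of_one_le_right (abs_nonneg _) h8
      nlinarith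
    have h11 := le_abs_self w
    have e : P.subObj lam S c u =
      P.model S u + P.hr u + 1 / (2 * lam) * ‖u - c‖ ^ 2 := rfl
    rw [e]
    linarith
  · rw [bundleObj_eq_top hP ⟨y, hy⟩ hSd hud]
    exact le_top

end Exist

/-- The state of the method after an iteration; `C` is the bundle set of the next iteration. -/
structure RunState (n : ℕ) where
  x : E n
  xc : E n
  xt : E n
  z : E n
  C : Finset (E n)

open Classical in
/-- One iteration of the method that keeps all cuts and resolves ties in favor of new points. -/
noncomputable def runStep (P : Inst) (lam δ : ℝ) (s : RunState P.n) : RunState P.n :=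
  let up : E P.n → EReal := fun u => P.phi u + ((1 / (2 * lam) * ‖u - s.xc‖ ^ 2 : ℝ) : EReal)
  let x := Classical.epsilon fun x => ∀ u, bundleObj P lam s.C s.xc x ≤ bundleObj P lam s.C s.xc u
  let xt := if up x ≤ up s.xt then x else s.xt
  let ser : Prop := up xt - bundleObj P lam s.C s.xc x ≤ (δ : EReal)
  { x := x
    xc := if ser then x else s.xc
    xt := xt
    z := if ser then (if P.phi xt ≤ P.phi s.z then xt else s.z) else s.z
    C := insert x s.C }

/-- The states of the canonical run. -/
noncomputable def runStates (P : Inst) (lam δ : ℝ) : ℕ → RunState P.n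
  | 0 => ⟨P.x0, P.x0, P.x0, P.x0, {P.x0}⟩
  | j + 1 => runStep P lam δ (runStates P lam δ j)

/-- The canonical run. -/
noncomputable def canonicalRun (P : Inst) (lam δ : ℝ) : Trace P.n where
  x j := (runStates P lam δ j).x
  xc j := (runStates P lam δ j).xc
  xt j := (runStates P lam δ j).xt
  z j := (runStates P lam δ j).z
  -- A state stores the bundle of the next iteration, hence the shift. The truncated value at 0 is
  -- unconstrained by `Trace.IsRun`.
  C j := (runStates P lam δ (j - 1)).C

/-- A nonempty bundle inside dom h guarantees that the choice operator returns a true minimizer,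
which again lies in dom h and keeps the invariant. -/
lemma canonicalRun_bundle {P : Inst} {μ Mf R0 lam : ℝ} (hP : P ∈ instClass μ Mf R0)
    (hlam : 0 < lam) (δ : ℝ) (j : ℕ) :
    (runStates P lam δ j).C.Nonempty ∧ (∀ y ∈ (runStates P lam δ j).C, y ∈ edom P.h) ∧
      ∀ y ∈ (runStates P lam δ j).C, ∃ i < j + 1, y = (runStates P lam δ i).x := by
  induction j with
  | zero =>
    refine ⟨Finset.singleton_nonempty _, fun y hy => ?_, fun y hy => ⟨0, by omega, ?_⟩⟩
    · rw [Finset.mem_singleton.1 hy]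
      exact hP.1
    · exact Finset.mem_singleton.1 hy
  | succ j ih =>
    obtain ⟨h1, h2, h3⟩ := ih
    have hC : (runStates P lam δ (j + 1)).C =
      insert (runStates P lam δ (j + 1)).x (runStates P lam δ j).C := rfl
    have hx := mem_edom_of_bundleObj_min hP h1 h2 (Classical.epsilon_spec
      (exists_bundleObj_min hP hlam h1 h2 (runStates P lam δ j).xc))
    rw [hC]
    refine ⟨Finset.insert_nonempty _ _, fun y hy => ?_, fun y hy => ?_⟩
    · rcases Finset.mem_insert.1 hy with rfl | hy
      · exact hx
      · exact h2 y hy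
    · rcases Finset.mem_insert.1 hy with rfl | hy
      · exact ⟨j + 1, by omega, rfl⟩
      · obtain ⟨i, hi, h⟩ := h3 y hy
        exact ⟨i, by omega, h⟩

lemma canonicalRun_isRun {P : Inst} {μ Mf R0 lam : ℝ} (hP : P ∈ instClass μ Mf R0)
    (hlam : 0 < lam) (δ : ℝ) : (canonicalRun P lam δ).IsRun (P := P) lam δ := by
  classical
  have hstep : ∀ j, runStates P lam δ (j + 1) = runStep P lam δ (runStates P lam δ j) :=
    fun _ => rfl
  have hser : ∀ j, (canonicalRun P lam δ).Serious (P := P) lam δ (j + 1) ↔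
      (P.phi (runStates P lam δ (j + 1)).xt + ((1 / (2 * lam) *
        ‖(runStates P lam δ (j + 1)).xt - (runStates P lam δ j).xc‖ ^ 2 : ℝ) : EReal)) -
        bundleObj P lam (runStates P lam δ j).C (runStates P lam δ j).xc
          (runStates P lam δ (j + 1)).x ≤ (δ : EReal) := by
    intro j
    rw [Trace.Serious]
    simp only [Nat.add_eq_zero_iff, one_ne_zero, and_false, false_or]
    exact Iff.rfl
  refine
    { x_zero := rfl, xc_zero := rfl, xt_zero := rfl, z_zero := rfl, C_one := rfl, C_sub := ?_,
      x_min := ?_, xt_mem := ?_, xt_le := ?_, C_mem := ?_, xc_serious := ?_, z_mem := ?_,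
      z_le := ?_, xc_null := ?_, z_null := ?_, C_active := ?_, C_null := ?_ }
  all_goals
    intro j hj
    obtain ⟨j, rfl⟩ := Nat.exists_eq_add_of_le' hj
  · exact (canonicalRun_bundle hP hlam δ j).2.2
  · obtain ⟨h1, h2, _⟩ := canonicalRun_bundle hP hlam δ j
    exact Classical.epsilon_spec (exists_bundleObj_min hP hlam h1 h2 (runStates P lam δ j).xc)
  · change (runStates P lam δ (j + 1)).xt = (runStates P lam δ (j + 1)).x ∨
      (runStates P lam δ (j + 1)).xt = (runStates P lam δ j).xt
    rw [hstep]
    simp only [runStep]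
    split_ifs
    · exact Or.inl rfl
    · exact Or.inr rfl
  · change (P.phi (runStates P lam δ (j + 1)).xt + ((1 / (2 * lam) *
        ‖(runStates P lam δ (j + 1)).xt - (runStates P lam δ j).xc‖ ^ 2 : ℝ) : EReal)) ≤
      (P.phi (runStates P lam δ (j + 1)).x + ((1 / (2 * lam) *
        ‖(runStates P lam δ (j + 1)).x - (runStates P lam δ j).xc‖ ^ 2 : ℝ) : EReal)) ∧
      (P.phi (runStates P lam δ (j + 1)).xt + ((1 / (2 * lam) *
        ‖(runStates P lam δ (j + 1)).xt - (runStates P lam δ j).xc‖ ^ 2 : ℝ) : EReal)) ≤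
      (P.phi (runStates P lam δ j).xt + ((1 / (2 * lam) *
        ‖(runStates P lam δ j).xt - (runStates P lam δ j).xc‖ ^ 2 : ℝ) : EReal))
    rw [hstep]
    simp only [runStep]
    split_ifs with h
    · exact ⟨le_rfl, h⟩
    · exact ⟨(not_le.1 h).le, le_rfl⟩
  · exact Finset.mem_insert_self _ _
  · exact fun h => if_pos ((hser j).1 h)
  · intro h
    have hz : (runStates P lam δ (j + 1)).z =
        if P.phi (runStates P lam δ (j + 1)).xt ≤ P.phi (runStates P lam δ j).z
        then (runStates P lam δ (j + 1)).xt else (runStates P lam δ j).z :=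
      if_pos ((hser j).1 h)
    change (runStates P lam δ (j + 1)).z = (runStates P lam δ j).z ∨
      (runStates P lam δ (j + 1)).z = (runStates P lam δ (j + 1)).xt
    by_cases h' : P.phi (runStates P lam δ (j + 1)).xt ≤ P.phi (runStates P lam δ j).z
    · exact Or.inr (hz.trans (if_pos h'))
    · exact Or.inl (hz.trans (if_neg h'))
  · intro h
    have hz : (runStates P lam δ (j + 1)).z =
        if P.phi (runStates P lam δ (j + 1)).xt ≤ P.phi (runStates P lam δ j).z
        then (runStates P lam δ (j + 1)).xt else (runStates P lam δ j).z :=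
      if_pos ((hser j).1 h)
    change P.phi (runStates P lam δ (j + 1)).z ≤ P.phi (runStates P lam δ j).z ∧
      P.phi (runStates P lam δ (j + 1)).z ≤ P.phi (runStates P lam δ (j + 1)).xt
    by_cases h' : P.phi (runStates P lam δ (j + 1)).xt ≤ P.phi (runStates P lam δ j).z
    · rw [hz.trans (if_pos h')]
      exact ⟨h', le_rfl⟩
    · rw [hz.trans (if_neg h')]
      exact ⟨le_rfl, (not_le.1 h').le⟩
  · exact fun h => if_neg fun h' => h ((hser j).2 h')
  · exact fun h => if_neg fun h' => h ((hser j).2 h')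
  · exact fun _ y hy _ => Finset.mem_insert_of_mem hy
  · exact fun _ y hy => (Finset.mem_insert.1 hy).symm

/-! ### The span property -/

section Span

variable {P : Inst} {μ Mf R0 lam δ : ℝ} {T : Trace P.n}

/-- Midpoint convexity at ±v for a unit vector v; such a vector exists because n ≥ 1. -/
lemma nonneg_of_quadratic (hP : P ∈ instClass μ Mf R0) (hμ : 0 ≤ μ) {a : ℝ} {b : E P.n} {e : ℝ}
    (hh : ∀ y, P.hr y = a / 2 * ‖y‖ ^ 2 + inner ℝ b y + e) (hd : ∀ y, y ∈ edom P.h) :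
    0 ≤ a := by
  set v : E P.n := EuclideanSpace.single ⟨0, P.n_pos⟩ 1 with hv
  have hv1 : ‖v‖ = 1 := by simp [hv]
  have h := (strongConvexOn_hr hP).2 (hd v) (hd (-v)) (by norm_num : (0 : ℝ) ≤ 1 / 2)
    (by norm_num : (0 : ℝ) ≤ 1 / 2) (by norm_num)
  have h0 : (1 / 2 : ℝ) • v + (1 / 2 : ℝ) • -v = 0 := by module
  rw [h0, hh, hh, hh, norm_zero, inner_zero_right, norm_neg, inner_neg_right, hv1] at h
  simp only [smul_eq_mul] at h
  have : 0 ≤ μ / 2 * ‖v - -v‖ ^ 2 := by positivity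
  nlinarith

/-- Removing the component q of x_{j+1} - x₀ orthogonal to the span leaves every cut unchanged and
lowers h and the prox term by (a/2 + 1/(2λ))‖q‖². Minimality forces q = 0. -/
lemma x_sub_mem_span (hT : T.IsRun (P := P) lam δ) (hP : P ∈ instClass μ Mf R0) (hμ : 0 ≤ μ)
    (hlam : 0 < lam) {a : ℝ} {b : E P.n} {e : ℝ}
    (hh : ∀ y, P.h y = ((a / 2 * ‖y‖ ^ 2 + inner ℝ b y + e : ℝ) : EReal)) (j : ℕ) :
    T.x j - P.x0 ∈ Submodule.span ℝ {v | ∃ i < j, v = P.f' (T.x i) ∨ v = a • T.x i + b} := by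
  have hd : ∀ y, y ∈ edom P.h := fun y => by
    change P.h y < ⊤
    rw [hh]
    exact EReal.coe_lt_top _
  have hhr : ∀ y, P.hr y = a / 2 * ‖y‖ ^ 2 + inner ℝ b y + e := fun y => by
    rw [Inst.hr, hh, EReal.toReal_coe]
  have ha := nonneg_of_quadratic hP hμ hhr hd
  induction j using Nat.strong_induction_on with
  | _ j ih =>
    rcases j with _ | j
    · rw [hT.x_zero, sub_self]
      exact Submodule.zero_mem _
    set V := Submodule.span ℝ {v | ∃ i < j + 1, v = P.f' (T.x i) ∨ v = a • T.x i + b} with hV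
    have hc : T.xc j - P.x0 ∈ V := by
      obtain ⟨i, hi, h⟩ := exists_xc_eq hT j
      rw [h]
      refine Submodule.span_mono ?_ (ih i (by omega))
      rintro v ⟨k, hk, hv⟩
      exact ⟨k, by omega, hv⟩
    have hg : a • P.x0 + b ∈ V :=
      Submodule.subset_span ⟨0, by omega, Or.inr (by rw [hT.x_zero])⟩
    set p := V.starProjection (T.x (j + 1) - P.x0) with hp
    set q := T.x (j + 1) - P.x0 - p with hq
    have hpV : p ∈ V := Submodule.starProjection_apply_mem _ _
    have hqV : ∀ v ∈ V, inner ℝ v q = 0 := fun v hv =>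
      (Submodule.mem_orthogonal V q).1 (Submodule.sub_starProjection_mem_orthogonal _) v hv
    set u := P.x0 + p with hu
    have hx : T.x (j + 1) = u + q := by rw [hu, hq]; abel
    have hmin := subObj_min hT hP j (hd u)
    have hm : P.model (T.C (j + 1)) u ≤ P.model (T.C (j + 1)) (T.x (j + 1)) := by
      obtain ⟨y, hy, h⟩ := exists_cut_eq_model hP ⟨_, x_mem_C_succ hT j⟩
        (C_subset_edom hT hP j) u
      refine h.trans_le (le_trans (le_of_eq ?_)
        (cut_le_model hP (C_subset_edom hT hP j) hy (T.x (j + 1))))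
      obtain ⟨i, hi, rfl⟩ := hT.C_sub (j + 1) (by omega) y hy
      have h0 := hqV _ (Submodule.subset_span ⟨i, hi, Or.inl rfl⟩)
      have e1 : T.x (j + 1) - T.x i = (u - T.x i) + q := by rw [hx]; abel
      rw [Inst.cut, Inst.cut, e1, inner_add_right, h0, add_zero]
    have e1 : ‖T.x (j + 1)‖ ^ 2 = ‖u‖ ^ 2 + 2 * inner ℝ u q + ‖q‖ ^ 2 := by
      rw [hx, norm_add_sq_real]
    have e2 : inner ℝ b (T.x (j + 1)) = inner ℝ b u + inner ℝ b q := by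
      rw [hx, inner_add_right]
    have e3 : ‖T.x (j + 1) - T.xc j‖ ^ 2 = ‖u - T.xc j‖ ^ 2 + ‖q‖ ^ 2 := by
      have : T.x (j + 1) - T.xc j = (u - T.xc j) + q := by rw [hx]; abel
      have h0 : inner ℝ (u - T.xc j) q = 0 := by
        refine hqV _ ?_
        have : u - T.xc j = p - (T.xc j - P.x0) := by rw [hu]; abel
        rw [this]
        exact V.sub_mem hpV hc
      rw [this, norm_add_sq_real, h0]
      ring
    -- The gradient a u + b = (a x₀ + b) + a p lies in the span, so the linear change of h along q
    -- vanishes.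
    have e4 : a * inner ℝ u q + inner ℝ b q = 0 := by
      have h0 := hqV _ hg
      have h1 := hqV _ hpV
      rw [inner_add_left, inner_smul_left, conj_trivial] at h0
      rw [hu, inner_add_left, h1, add_zero, h0]
    simp only [Inst.subObj] at hmin
    rw [hhr, hhr, e1, e2, e3] at hmin
    have h5 : (a / 2 + 1 / (2 * lam)) * ‖q‖ ^ 2 ≤ 0 := by nlinarith
    have h6 : 0 < a / 2 + 1 / (2 * lam) := by positivity
    have h7 : ‖q‖ ^ 2 ≤ 0 := by
      by_contra! h
      exact absurd h5 (not_le.2 (mul_pos h6 h))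
    have h8 : q = 0 := by
      have := pow_eq_zero_iff two_ne_zero |>.1 (le_antisymm h7 (sq_nonneg _))
      exact norm_eq_zero.1 this
    rw [hx, h8, hu]
    have : P.x0 + p + 0 - P.x0 = p := by abel
    rw [this]
    exact hpV

end Span

/-! ### A resisting instance -/

/-- Breaking ties towards the smallest index makes the oracle adversarial: it reveals coordinates in
order. -/
lemma exists_first_argmax {m : ℕ} (x : E (m + 1)) :
    ∃ i, (∀ k, x k ≤ x i) ∧ ∀ k < i, x k < x i := by
  classical
  obtain ⟨i₀, hi₀⟩ := Finite.exists_max (fun k => x k)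
  have hne : (Finset.univ.filter fun i => x i = x i₀).Nonempty := ⟨i₀, by simp⟩
  have hmem := Finset.min'_mem _ hne
  set i := Finset.min' _ hne with hi
  have hxi : x i = x i₀ := (Finset.mem_filter.1 hmem).2
  refine ⟨i, fun k => hxi ▸ hi₀ k, fun k hk => lt_of_le_of_ne (hxi ▸ hi₀ k) fun h => ?_⟩
  exact absurd (Finset.min'_le _ k (by simp [h, hxi])) (not_le.2 hk)

/-- The first index at which the largest coordinate is attained. -/
noncomputable def topIdx {m : ℕ} (x : E (m + 1)) : Fin (m + 1) := (exists_first_argmax x).choose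

lemma le_topIdx {m : ℕ} (x : E (m + 1)) (k : Fin (m + 1)) : x k ≤ x (topIdx x) :=
  (exists_first_argmax x).choose_spec.1 k

lemma lt_topIdx {m : ℕ} (x : E (m + 1)) {k : Fin (m + 1)} (hk : k < topIdx x) :
    x k < x (topIdx x) :=
  (exists_first_argmax x).choose_spec.2 k hk

/-- The nonsmooth part `γ max {x₁, …, xₙ, -ρ}`. -/
noncomputable def hardFun {m : ℕ} (γ ρ : ℝ) (x : E (m + 1)) : ℝ := γ * max (x (topIdx x)) (-ρ)

/-- A subgradient oracle of `hardFun`. -/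
noncomputable def hardGrad {m : ℕ} (γ ρ : ℝ) (x : E (m + 1)) : E (m + 1) :=
  open Classical in if -ρ < x (topIdx x) then EuclideanSpace.single (topIdx x) γ else 0

/-- The instance with `f = γ max {x₁, …, xₙ, -ρ}`, `h = μ‖·‖²/2` and `x₀ = 0`. -/
noncomputable def hardInst (m : ℕ) (γ ρ μ : ℝ) : Inst where
  n := m + 1
  n_pos := m.succ_pos
  f x := (hardFun γ ρ x : EReal)
  h x := ((μ / 2 * ‖x‖ ^ 2 : ℝ) : EReal)
  f' := hardGrad γ ρ
  x0 := 0

section Hard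

variable {m : ℕ} {γ ρ μ : ℝ}

lemma hardFun_subgrad (hγ : 0 ≤ γ) (x u : E (m + 1)) :
    hardFun γ ρ x + inner ℝ (hardGrad γ ρ x) (u - x) ≤ hardFun γ ρ u := by
  unfold hardGrad hardFun
  split_ifs with h
  · rw [EuclideanSpace.inner_single_left, max_eq_left h.le, conj_trivial, PiLp.sub_apply]
    have h1 : γ * u (topIdx x) ≤ γ * max (u (topIdx u)) (-ρ) :=
      mul_le_mul_of_nonneg_left ((le_topIdx u _).trans (le_max_left _ _)) hγ
    linarith
  · rw [max_eq_right (not_lt.1 h), inner_zero_left, add_zero]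
    exact mul_le_mul_of_nonneg_left (le_max_right _ _) hγ

lemma norm_hardGrad_le (hγ : 0 ≤ γ) (x : E (m + 1)) : ‖hardGrad γ ρ x‖ ≤ γ := by
  unfold hardGrad
  split_ifs
  · simp [abs_of_nonneg hγ]
  · simpa using hγ

lemma continuous_hardFun (hγ : 0 ≤ γ) : Continuous (hardFun (m := m) γ ρ) := by
  refine (LipschitzWith.of_le_add_mul γ.toNNReal fun x y => ?_).continuous
  have h1 := hardFun_subgrad (ρ := ρ) hγ x y
  have h2 := (abs_le.1 (abs_real_inner_le_norm (hardGrad γ ρ x) (y - x))).1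
  have h3 := mul_le_mul_of_nonneg_right (norm_hardGrad_le (ρ := ρ) hγ x) (norm_nonneg (y - x))
  rw [dist_eq_norm, norm_sub_rev, Real.coe_toNNReal _ hγ]
  linarith

/-- Convexity follows from having a subgradient everywhere: average the two subgradient inequalities
at the convex combination. -/
lemma isClosedConvex_hardFun (hγ : 0 ≤ γ) :
    IsClosedConvex fun x : E (m + 1) => (hardFun γ ρ x : EReal) := by
  refine ⟨fun x => EReal.coe_ne_bot _, ⟨0, EReal.coe_lt_top _⟩,
    (continuous_coe_real_ereal.comp (continuous_hardFun hγ)).lowerSemicontinuous, ?_⟩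
  intro z _ u _ α h0 h1
  simp only [EReal.toReal_coe]
  rw [EReal.coe_le_coe_iff]
  set w := α • z + (1 - α) • u with hw
  have h2 := hardFun_subgrad (ρ := ρ) hγ w z
  have h3 := hardFun_subgrad (ρ := ρ) hγ w u
  have h4 : α * inner ℝ (hardGrad γ ρ w) (z - w) +
      (1 - α) * inner ℝ (hardGrad γ ρ w) (u - w) = 0 := by
    rw [← inner_smul_right, ← inner_smul_right, ← inner_add_right]
    have : α • (z - w) + (1 - α) • (u - w) = 0 := by
      rw [hw]
      module
    rw [this, inner_zero_right]
  have h5 := mul_le_mul_of_nonneg_left h2 h0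
  have h6 := mul_le_mul_of_nonneg_left h3 (by linarith : 0 ≤ 1 - α)
  nlinarith

lemma isMuConvex_sq {n : ℕ} {ν : ℝ} (hν : ν ≤ μ) :
    IsMuConvex ν fun x : E n => ((μ / 2 * ‖x‖ ^ 2 : ℝ) : EReal) := by
  intro z _ u _ α h0 h1
  simp only [EReal.toReal_coe]
  rw [EReal.coe_le_coe_iff]
  have h := norm_sq_convex_combination z u 0 (by ring : α + (1 - α) = 1)
  simp only [sub_zero] at h
  rw [h]
  have h2 : 0 ≤ (μ - ν) * (α * (1 - α) * ‖z - u‖ ^ 2) :=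
    mul_nonneg (by linarith) (mul_nonneg (mul_nonneg h0 (by linarith)) (sq_nonneg _))
  nlinarith

lemma isClosedConvex_sq {n : ℕ} (hμ : 0 ≤ μ) :
    IsClosedConvex fun x : E n => ((μ / 2 * ‖x‖ ^ 2 : ℝ) : EReal) :=
  ⟨fun x => EReal.coe_ne_bot _, ⟨0, EReal.coe_lt_top _⟩,
    (continuous_coe_real_ereal.comp (by fun_prop)).lowerSemicontinuous, isMuConvex_sq hμ⟩

lemma hardInst_phi (x : E (m + 1)) :
    (hardInst m γ ρ μ).phi x = ((hardFun γ ρ x + μ / 2 * ‖x‖ ^ 2 : ℝ) : EReal) :=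
  (EReal.coe_add _ _).symm

/-- The point with all coordinates equal to `-t`. -/
noncomputable def diagPoint (m : ℕ) (t : ℝ) : E (m + 1) := WithLp.toLp 2 fun _ => -t

lemma norm_sq_diagPoint (t : ℝ) : ‖diagPoint m t‖ ^ 2 = (m + 1) * t ^ 2 := by
  rw [EuclideanSpace.norm_sq_eq]
  simp [diagPoint]

lemma hardFun_diagPoint {t : ℝ} (ht : t ≤ ρ) : hardFun γ ρ (diagPoint m t) = -(γ * t) := by
  have : diagPoint m t (topIdx (diagPoint m t)) = -t := rfl
  rw [hardFun, this, max_eq_left (by linarith)]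
  ring

/-- The level of the minimizer of the resisting instance. -/
lemma exists_optimal_level (hγ : 0 < γ) (hρ : 0 ≤ ρ) (μ : ℝ) (m : ℕ) :
    ∃ t, 0 ≤ t ∧ t ≤ ρ ∧ μ * (m + 1) * t ≤ γ ∧ (t = ρ ∨ μ * (m + 1) * t = γ) := by
  by_cases h : μ * (m + 1) * ρ ≤ γ
  · exact ⟨ρ, hρ, le_rfl, h, Or.inl rfl⟩
  · rw [not_le] at h
    have hρ' : 0 < ρ := by
      rcases hρ.eq_or_lt with h0 | h0
      · rw [← h0, mul_zero] at h
        exact absurd hγ h.not_gt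
      · exact h0
    have hμ : 0 < μ * (m + 1) := pos_of_mul_pos_left (hγ.trans h) hρ'.le
    refine ⟨γ / (μ * (m + 1)), by positivity, ?_, ?_, Or.inr ?_⟩
    · rw [div_le_iff₀ hμ]
      linarith
    · rw [mul_div_cancel₀ _ hμ.ne']
    · rw [mul_div_cancel₀ _ hμ.ne']

/-- Any u is dominated by the diagonal point at a level s in [0, ρ], which leaves the scalar problem
of minimizing -γs + μ(m + 1)s²/2 there; the hypotheses on t are its optimality conditions. -/
lemma diagPoint_mem_argmin (hγ : 0 ≤ γ) (hρ : 0 ≤ ρ) (hμ : 0 ≤ μ) {t : ℝ} (ht : t ≤ ρ)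
    (h1 : μ * (m + 1) * t ≤ γ) (h2 : t = ρ ∨ μ * (m + 1) * t = γ) :
    diagPoint m t ∈ (hardInst m γ ρ μ).argmin := by
  intro (u : E (m + 1))
  rw [hardInst_phi, hardInst_phi, EReal.coe_le_coe_iff, hardFun_diagPoint ht, norm_sq_diagPoint]
  -- Clipping minus the largest coordinate to [0, ρ] ensures both |u_i| ≥ s for all i and a
  -- nonsmooth part of at least -γs.
  set s := min (max (-u (topIdx u)) 0) ρ with hs
  have hs0 : 0 ≤ s := le_min (le_max_right _ _) hρ
  have hsρ : s ≤ ρ := min_le_right _ _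
  have hf : -(γ * s) ≤ hardFun γ ρ u := by
    rw [hardFun, ← mul_neg]
    refine mul_le_mul_of_nonneg_left ?_ hγ
    rcases le_total (max (-u (topIdx u)) 0) ρ with h | h
    · rw [hs, min_eq_left h]
      refine le_trans ?_ (le_max_left _ _)
      have := le_max_left (-u (topIdx u)) 0
      linarith
    · rw [hs, min_eq_right h]
      exact le_max_right _ _
  have hn : (m + 1) * s ^ 2 ≤ ‖u‖ ^ 2 := by
    rw [EuclideanSpace.norm_sq_eq]
    have : ∑ _i : Fin (m + 1), s ^ 2 ≤ ∑ i, ‖u i‖ ^ 2 := by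
      refine Finset.sum_le_sum fun i _ => pow_le_pow_left₀ hs0 ?_ 2
      rw [Real.norm_eq_abs]
      refine (min_le_left _ _).trans (max_le ?_ (abs_nonneg _))
      have := neg_abs_le (u i)
      have := le_topIdx u i
      linarith
    simpa using this
  have hg : -(γ * t) + μ / 2 * ((m + 1) * t ^ 2) ≤ -(γ * s) + μ / 2 * ((m + 1) * s ^ 2) := by
    have hk : 0 ≤ μ * (m + 1) := by positivity
    set κ := μ * (m + 1) with hκ
    have e : ∀ r : ℝ, μ / 2 * ((m + 1) * r ^ 2) = κ / 2 * r ^ 2 := fun r => by rw [hκ]; ring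
    rw [e, e]
    rcases h2 with rfl | h2
    · nlinarith [mul_nonneg (sub_nonneg.2 hsρ) (sub_nonneg.2 h1), mul_nonneg hk (sq_nonneg (s - t))]
    · rw [← h2]
      nlinarith [mul_nonneg hk (sq_nonneg (s - t))]
  have := mul_le_mul_of_nonneg_left hn (by linarith : 0 ≤ μ / 2)
  linarith

/-- The level R/√(m + 1) is the largest at which a diagonal point stays within distance R of the
origin. -/
lemma hardInst_mem {R : ℝ} (hγ : 0 < γ) (hR : 0 < R) (hμ : 0 ≤ μ) (m : ℕ) :
    hardInst m γ (R / √(m + 1)) μ ∈ instClassU μ γ R := by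
  have hs : 0 < √((m : ℝ) + 1) := Real.sqrt_pos.2 (by positivity)
  have hρ : 0 ≤ R / √(m + 1) := by positivity
  obtain ⟨t, ht0, htρ, h1, h2⟩ := exists_optimal_level hγ hρ μ m
  have harg := diagPoint_mem_argmin hγ.le hρ hμ htρ h1 h2
  refine ⟨⟨EReal.coe_lt_top _, ⟨isClosedConvex_hardFun hγ.le, isClosedConvex_sq hμ,
    fun _ _ => EReal.coe_lt_top _, fun x _ u => ?_⟩, ⟨_, harg⟩,
    ⟨isMuConvex_sq le_rfl, fun x _ => norm_hardGrad_le hγ.le x⟩, ?_⟩, fun _ => rfl⟩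
  · change (hardFun γ _ x : EReal) + ((inner ℝ (hardGrad γ _ x) (u - x) : ℝ) : EReal) ≤
      (hardFun γ _ u : EReal)
    rw [← EReal.coe_add, EReal.coe_le_coe_iff]
    exact hardFun_subgrad hγ.le x u
  · refine (Metric.infDist_le_dist_of_mem harg).trans ?_
    change dist (0 : E (m + 1)) (diagPoint m t) ≤ R
    rw [dist_zero_left]
    refine le_of_sq_le_sq ?_ hR.le
    rw [norm_sq_diagPoint]
    have h3 : t ^ 2 ≤ (R / √(m + 1)) ^ 2 := pow_le_pow_left₀ ht0 htρ 2
    rw [div_pow, Real.sq_sqrt (by positivity), le_div_iff₀ (by positivity)] at h3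
    linarith

/-- Points reached from the origin through the span of earlier oracle answers have few nonzero
coordinates. -/
lemma coord_eq_zero_of_span {x : ℕ → E (m + 1)} {J : ℕ} (hx0 : x 0 = 0)
    (hspan : ∀ j, 1 ≤ j → j < J → x j ∈ Submodule.span ℝ
      {v | ∃ i < j, v = hardGrad γ ρ (x i) ∨ v = μ • x i}) :
    ∀ j < J, j ≤ m → ∀ k : Fin (m + 1), j ≤ k → x j k = 0 := by
  intro j
  induction j using Nat.strong_induction_on with
  | _ j ih =>
    intro hj hjm k hk
    rcases Nat.eq_zero_or_pos j with rfl | hpos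
    · rw [hx0]
      rfl
    · refine Submodule.span_induction (p := fun v _ => v k = 0) ?_ rfl ?_ ?_ (hspan j hpos hj)
      · rintro v ⟨i, hi, rfl | rfl⟩
        · unfold hardGrad
          split_ifs
          · have hzero := ih i hi (by omega) (by omega)
            -- Coordinates from i on are all zero at x_i, so a first maximizer cannot lie beyond i.
            have htop : (topIdx (x i) : ℕ) ≤ i := by
              by_contra! hc
              have h1 := lt_topIdx (x i) (k := ⟨i, by omega⟩) (Fin.lt_def.2 hc)
              rw [hzero ⟨i, by omega⟩ le_rfl, hzero _ hc.le] at h1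
              exact lt_irrefl _ h1
            have hne : k ≠ topIdx (x i) := by
              rintro rfl
              omega
            simp [hne]
          · rfl
        · rw [PiLp.smul_apply, ih i hi (by omega) (by omega) k (by omega), smul_zero]
      · intro v w _ _ hv hw
        rw [PiLp.add_apply, hv, hw, add_zero]
      · intro a v _ hv
        rw [PiLp.smul_apply, hv, smul_zero]

/-- If J ≤ m + 1, the last coordinate of the final point is zero and its objective value is
nonnegative. The optimal value is at most -γt/2, which is below -ε: by `h1` if t = ρ, by `h2`
otherwise. -/
lemma lt_J_of_hardInst {R ε : ℝ} (hγ : 0 < γ) (hR : 0 < R) (hμ : 0 ≤ μ)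
    (hε : 0 < ε) (h1 : (m + 1 : ℝ) < γ ^ 2 * R ^ 2 / (4 * ε ^ 2))
    (h2 : μ * (m + 1) * (2 * ε) < γ ^ 2) {I : Set Inst} (hI : instClassU μ γ R ⊆ I)
    {A : Algorithm} (hA : A ∈ algClass I ε) :
    m + 2 ≤ A.J (hardInst m γ (R / √(m + 1)) μ) := by
  set ρ := R / √(m + 1) with hρdef
  have hs : 0 < √((m : ℝ) + 1) := Real.sqrt_pos.2 (by positivity)
  have hρ : 0 ≤ ρ := by positivity
  set P := hardInst m γ ρ μ
  obtain ⟨hJ, hx0, hsol, hspan⟩ := hA P (hI (hardInst_mem hγ hR hμ m))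
  by_contra! hc
  obtain ⟨j, hj⟩ : ∃ j, A.J P = j + 1 := ⟨A.J P - 1, by omega⟩
  set x : ℕ → E (m + 1) := A.x P
  have hz := coord_eq_zero_of_span (m := m) (ρ := ρ) (μ := μ) (x := x) (J := A.J P)
    hx0 (by
      intro j h1 h2
      have h := hspan μ 0 0 (fun y => by
        change ((μ / 2 * ‖y‖ ^ 2 : ℝ) : EReal) = _
        rw [inner_zero_left, add_zero, add_zero]) j h1 h2
      have e : A.x P j - P.x0 = x j := sub_zero (x j)
      rw [e] at h
      simp only [add_zero] at h
      exact h) j (by omega) (by omega)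
  have hsj := (hsol j (by omega)).2 (by omega)
  obtain ⟨t, ht0, htρ, h3, h4⟩ := exists_optimal_level hγ hρ μ m
  have h5 : (hardInst m γ ρ μ).phi (x j) ≤
      (hardInst m γ ρ μ).phi (diagPoint m t) + (ε : EReal) :=
    hsj.trans (add_le_add_left (iInf_le (fun u => P.phi u) (diagPoint m t)) _)
  rw [hardInst_phi, hardInst_phi, ← EReal.coe_add, EReal.coe_le_coe_iff,
    hardFun_diagPoint htρ, norm_sq_diagPoint] at h5
  have h6 : 0 ≤ hardFun γ ρ (x j) := by
    refine mul_nonneg hγ.le (le_trans ?_ (le_max_left _ _))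
    have := le_topIdx (x j) (Fin.last m)
    rwa [hz (Fin.last m) (by simp; omega)] at this
  have h7 : 0 ≤ μ / 2 * ‖x j‖ ^ 2 := by positivity
  have h8 : 2 * ε < γ * t := by
    rcases h4 with h4 | h4
    · rw [h4]
      have h9 : (2 * ε * √(m + 1)) ^ 2 < (γ * R) ^ 2 := by
        rw [mul_pow, Real.sq_sqrt (by positivity)]
        rw [lt_div_iff₀ (by positivity)] at h1
        linarith
      have h10 := lt_of_pow_lt_pow_left₀ 2 (by positivity) h9
      rw [hρdef, ← mul_div_assoc, lt_div_iff₀ hs]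
      exact h10
    · have hκ : 0 < μ * (m + 1) := by
        refine pos_of_mul_pos_left (h4 ▸ hγ) ht0
      refine lt_of_mul_lt_mul_left ?_ hκ.le
      calc μ * (m + 1) * (2 * ε) < γ ^ 2 := h2
        _ = μ * (m + 1) * (γ * t) := by rw [sq]; nth_rewrite 1 [← h4]; ring
  have h9 := mul_le_mul_of_nonneg_right h3 ht0
  nlinarith

/-- The lower complexity bound. -/
lemma isClassLower_max {R ε B : ℝ} (hγ : 0 < γ) (hR : 0 < R) (hμ : 0 ≤ μ) (hε : 0 < ε)
    (h1 : B ≤ γ ^ 2 * R ^ 2 / (4 * ε ^ 2)) (h2 : μ * B * (2 * ε) ≤ γ ^ 2)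
    {I : Set Inst} (hI : instClassU μ γ R ⊆ I) : IsClassLower I ε (max 1 B) := by
  rcases le_or_gt B 1 with hB | hB
  · have hmem := hI (hardInst_mem hγ hR hμ 0)
    refine ⟨_, hmem, fun A hA => ?_⟩
    rw [max_eq_left hB]
    exact_mod_cast (hA _ hmem).1
  · have hk : 1 < ⌈B⌉₊ := Nat.lt_ceil.2 (by exact_mod_cast hB)
    -- With this dimension m + 1 < B, giving the strict inequalities of the resisting instance,
    -- while B ≤ m + 2 ≤ J.
    obtain ⟨m, hm⟩ : ∃ m, ⌈B⌉₊ = m + 2 := ⟨⌈B⌉₊ - 2, by omega⟩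
    have hmB : (m + 1 : ℝ) < B := by
      have : m + 1 < ⌈B⌉₊ := by omega
      exact_mod_cast Nat.lt_ceil.1 this
    refine ⟨_, hI (hardInst_mem hγ hR hμ m), fun A hA => ?_⟩
    have h := lt_J_of_hardInst (m := m) hγ hR hμ hε (hmB.trans_le h1) (by
      rcases hμ.eq_or_lt with h0 | h0
      · rw [← h0]
        simp only [zero_mul]
        positivity
      · refine lt_of_lt_of_le ?_ h2
        gcongr) hI hA
    rw [max_eq_right hB.le]
    have h3 : B ≤ (m + 2 : ℕ) := hm ▸ Nat.le_ceil B
    exact h3.trans (by exact_mod_cast h)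

end Hard

/-! ### Iteration complexity -/

/-- Bernoulli's inequality; it moves constant factors out of the logarithm. -/
lemma log_one_add_mul_le {c y : ℝ} (hc : 1 ≤ c) (hy : 0 ≤ y) :
    Real.log (1 + c * y) ≤ c * Real.log (1 + y) := by
  have h := one_add_mul_self_le_rpow_one_add (by linarith : -1 ≤ y) hc
  rw [← Real.log_rpow (by linarith)]
  exact Real.log_le_log (by positivity) h

section Bound

variable {P : Inst} {μ Mf R0 lam ε T₁ c C : ℝ} {T : Trace P.n}

/-- Bounding every power of 1 + λμ below by 1, about 4R₀²/(λε) cycles suffice, each costing at most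
cλM_f²/ε. The extra cycle from rounding is absorbed by λ ≤ CR₀²/ε. -/
lemma exists_serious_sol_le_sq (hT : T.IsRun (P := P) lam (ε / 2)) (hP : P ∈ instClass μ Mf R0)
    (hlam : 0 < lam) (hμ : 0 ≤ μ) (hMf : 0 < Mf) (hε : 0 < ε) (hT₁ : 0 ≤ T₁)
    (hc : 0 ≤ c) (hC : lam ≤ C * R0 ^ 2 / ε) {xs : E P.n} (hxs : xs ∈ P.argmin)
    (hd : ‖P.x0 - xs‖ < 2 * R0)
    (hcyc : ∀ i, T.Serious (P := P) lam (ε / 2) i → ‖T.xc i - xs‖ ≤ ‖P.x0 - xs‖ →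
      T.realGap P lam i ≤ T₁)
    (hL : 2 + T₁ / (8 * Mf ^ 2 / (1 / lam + μ)) + 2 * (8 * Mf ^ 2 / (1 / lam + μ)) / (ε / 2) ≤
      c * (Mf ^ 2 / ((1 / lam + μ) * ε))) :
    ∃ N : ℕ, T.Serious (P := P) lam (ε / 2) N ∧ P.IsSol ε (T.z N) ∧
      (N : ℝ) ≤ c * (4 + C) * (Mf ^ 2 * R0 ^ 2 / ε ^ 2) := by
  have h2ε : 2 * (ε / 2) = ε := by ring
  have hk : ‖P.x0 - xs‖ ^ 2 < lam * (2 * (ε / 2)) *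
      ∑ l ∈ Finset.range (⌊4 * R0 ^ 2 / (lam * ε)⌋₊ + 1), (1 + lam * μ) ^ l := by
    have h1 : ‖P.x0 - xs‖ ^ 2 < (2 * R0) ^ 2 := pow_lt_pow_left₀ hd (norm_nonneg _) two_ne_zero
    have h2 := (Nat.lt_floor_add_one (4 * R0 ^ 2 / (lam * ε))).le
    rw [div_le_iff₀ (by positivity)] at h2
    have h3 : ((⌊4 * R0 ^ 2 / (lam * ε)⌋₊ + 1 : ℕ) : ℝ) ≤
        ∑ l ∈ Finset.range (⌊4 * R0 ^ 2 / (lam * ε)⌋₊ + 1), (1 + lam * μ) ^ l := by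
      have : ∑ _l ∈ Finset.range (⌊4 * R0 ^ 2 / (lam * ε)⌋₊ + 1), (1 : ℝ) ≤
          ∑ l ∈ Finset.range (⌊4 * R0 ^ 2 / (lam * ε)⌋₊ + 1), (1 + lam * μ) ^ l :=
        Finset.sum_le_sum fun l _ => one_le_pow₀ (by nlinarith [mul_nonneg hlam.le hμ])
      simpa using this
    have h4 := mul_le_mul_of_nonneg_left h3 (by positivity : 0 ≤ lam * ε)
    rw [h2ε]
    push_cast at h4 ⊢
    linarith
  obtain ⟨N, hN1, hN2, hN3⟩ := exists_serious_sol hT hP hlam hμ hMf (half_pos hε) hT₁ hxs hcyc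
    rfl hk
  rw [h2ε] at hN2
  refine ⟨N, hN1, hN2, hN3.trans ?_⟩
  have hW : Mf ^ 2 / ((1 / lam + μ) * ε) ≤ lam * Mf ^ 2 / ε := by
    rw [div_le_div_iff₀ (by positivity) hε]
    have e : lam * Mf ^ 2 * ((1 / lam + μ) * ε) = Mf ^ 2 * ε + lam * Mf ^ 2 * μ * ε := by
      field_simp
    rw [e]
    have : 0 ≤ lam * Mf ^ 2 * μ * ε := by positivity
    linarith
  have hfl : ((⌊4 * R0 ^ 2 / (lam * ε)⌋₊ + 1 : ℕ) : ℝ) ≤ 4 * R0 ^ 2 / (lam * ε) + 1 := by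
    push_cast
    linarith [Nat.floor_le (by positivity : 0 ≤ 4 * R0 ^ 2 / (lam * ε))]
  have hA : lam * Mf ^ 2 / ε ≤ C * (Mf ^ 2 * R0 ^ 2 / ε ^ 2) := by
    have := mul_le_mul_of_nonneg_right hC (by positivity : 0 ≤ Mf ^ 2 / ε)
    calc lam * Mf ^ 2 / ε = lam * (Mf ^ 2 / ε) := by ring
      _ ≤ C * R0 ^ 2 / ε * (Mf ^ 2 / ε) := this
      _ = C * (Mf ^ 2 * R0 ^ 2 / ε ^ 2) := by field_simp
  refine (mul_le_mul_of_nonneg_left hL (Nat.cast_nonneg _)).trans ?_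
  calc ((⌊4 * R0 ^ 2 / (lam * ε)⌋₊ + 1 : ℕ) : ℝ) * (c * (Mf ^ 2 / ((1 / lam + μ) * ε)))
      ≤ (4 * R0 ^ 2 / (lam * ε) + 1) * (c * (lam * Mf ^ 2 / ε)) := by gcongr
    _ = c * (4 * (Mf ^ 2 * R0 ^ 2 / ε ^ 2) + lam * Mf ^ 2 / ε) := by field_simp
    _ ≤ c * (4 * (Mf ^ 2 * R0 ^ 2 / ε ^ 2) + C * (Mf ^ 2 * R0 ^ 2 / ε ^ 2)) := by gcongr
    _ = c * (4 + C) * (Mf ^ 2 * R0 ^ 2 / ε ^ 2) := by ring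

/-- Summing the geometric series, the cycle count is about log(1 + 4y)/log(1 + q). Since M_f²/(σε) =
B(1 - 1/(1 + q)) ≤ B log(1 + q) with σ = 1/λ + μ, the denominator cancels. -/
lemma exists_serious_sol_le_log (hT : T.IsRun (P := P) lam (ε / 2)) (hP : P ∈ instClass μ Mf R0)
    (hlam : 0 < lam) (hμ : 0 < μ) (hMf : 0 < Mf) (hε : 0 < ε) (hT₁ : 0 ≤ T₁)
    (hc : 0 ≤ c) (hC : lam ≤ C * R0 ^ 2 / ε) {xs : E P.n} (hxs : xs ∈ P.argmin)
    (hd : ‖P.x0 - xs‖ < 2 * R0)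
    (hcyc : ∀ i, T.Serious (P := P) lam (ε / 2) i → ‖T.xc i - xs‖ ≤ ‖P.x0 - xs‖ →
      T.realGap P lam i ≤ T₁)
    (hL : 2 + T₁ / (8 * Mf ^ 2 / (1 / lam + μ)) + 2 * (8 * Mf ^ 2 / (1 / lam + μ)) / (ε / 2) ≤
      c * (Mf ^ 2 / ((1 / lam + μ) * ε))) :
    ∃ N : ℕ, T.Serious (P := P) lam (ε / 2) N ∧ P.IsSol ε (T.z N) ∧
      (N : ℝ) ≤ c * (4 + max C 1) *
        ((Mf ^ 2 / (μ * ε) + 1) * Real.log (μ * R0 ^ 2 / ε + 1)) := by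
  have h2ε : 2 * (ε / 2) = ε := by ring
  set y := μ * R0 ^ 2 / ε with hy
  set q := lam * μ with hq
  have hq0 : 0 < q := mul_pos hlam hμ
  have hy0 : 0 ≤ y := by positivity
  have hlogq : 0 < Real.log (1 + q) := Real.log_pos (by linarith)
  have hlogy : 0 ≤ Real.log (1 + y) := Real.log_nonneg (by linarith)
  have hlog4 : 0 ≤ Real.log (1 + 4 * y) := Real.log_nonneg (by linarith)
  set k := ⌊Real.log (1 + 4 * y) / Real.log (1 + q)⌋₊ + 1 with hkdef
  have hk : ‖P.x0 - xs‖ ^ 2 < lam * (2 * (ε / 2)) * ∑ l ∈ Finset.range k, (1 + q) ^ l := by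
    have h1 : ‖P.x0 - xs‖ ^ 2 < (2 * R0) ^ 2 := pow_lt_pow_left₀ hd (norm_nonneg _) two_ne_zero
    have h2 := Nat.lt_floor_add_one (Real.log (1 + 4 * y) / Real.log (1 + q))
    rw [div_lt_iff₀ hlogq] at h2
    have h3 : 1 + 4 * y < (1 + q) ^ k := by
      rw [← Real.log_lt_log_iff (by positivity) (by positivity), Real.log_pow, hkdef]
      exact_mod_cast h2
    have h4 := geom_sum_mul (1 + q) k
    rw [add_sub_cancel_left] at h4
    have h5 : 4 * y < (∑ l ∈ Finset.range k, (1 + q) ^ l) * q := by linarith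
    have h6 : 4 * R0 ^ 2 < lam * ε * ∑ l ∈ Finset.range k, (1 + q) ^ l := by
      have h7 : 4 * y = 4 * R0 ^ 2 * (μ / ε) := by rw [hy]; ring
      have h8 : (∑ l ∈ Finset.range k, (1 + q) ^ l) * q =
          (lam * ε * ∑ l ∈ Finset.range k, (1 + q) ^ l) * (μ / ε) := by
        rw [hq]
        field_simp
      rw [h7, h8] at h5
      exact lt_of_mul_lt_mul_right h5 (by positivity)
    rw [h2ε]
    linarith
  obtain ⟨N, hN1, hN2, hN3⟩ := exists_serious_sol hT hP hlam hμ.le hMf (half_pos hε) hT₁ hxs hcyc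
    rfl hk
  rw [h2ε] at hN2
  refine ⟨N, hN1, hN2, hN3.trans ((mul_le_mul_of_nonneg_left hL (Nat.cast_nonneg _)).trans ?_)⟩
  set B := Mf ^ 2 / (μ * ε) with hB
  have hB0 : 0 ≤ B := by positivity
  have hW : Mf ^ 2 / ((1 / lam + μ) * ε) ≤ B * Real.log (1 + q) := by
    have e : Mf ^ 2 / ((1 / lam + μ) * ε) = B * (1 - (1 + q)⁻¹) := by
      rw [hB, hq]
      have : 1 + lam * μ ≠ 0 := by positivity
      field_simp
      ring
    rw [e]
    exact mul_le_mul_of_nonneg_left (Real.one_sub_inv_le_log_of_pos (by linarith)) hB0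
  have hqy : Real.log (1 + q) ≤ max C 1 * Real.log (1 + y) := by
    refine le_trans (Real.log_le_log (by linarith) ?_)
      (log_one_add_mul_le (le_max_right C 1) hy0)
    have h1 := mul_le_mul_of_nonneg_right hC hμ.le
    have h2 : C * R0 ^ 2 / ε * μ = C * y := by rw [hy]; ring
    have h3 := mul_le_mul_of_nonneg_right (le_max_left C 1) hy0
    linarith
  have hfl : (k : ℝ) ≤ Real.log (1 + 4 * y) / Real.log (1 + q) + 1 := by
    rw [hkdef]
    push_cast
    linarith [Nat.floor_le (div_nonneg hlog4 hlogq.le)]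
  have h4y : Real.log (1 + 4 * y) ≤ 4 * Real.log (1 + y) :=
    log_one_add_mul_le (by norm_num) hy0
  rw [add_comm y 1]
  calc (k : ℝ) * (c * (Mf ^ 2 / ((1 / lam + μ) * ε)))
      ≤ (Real.log (1 + 4 * y) / Real.log (1 + q) + 1) * (c * (B * Real.log (1 + q))) := by gcongr
    _ = c * B * (Real.log (1 + 4 * y) + Real.log (1 + q)) := by field_simp
    _ ≤ c * B * (4 * Real.log (1 + y) + max C 1 * Real.log (1 + y)) := by gcongr
    _ = c * (4 + max C 1) * (B * Real.log (1 + y)) := by ring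
    _ ≤ c * (4 + max C 1) * ((B + 1) * Real.log (1 + y)) := by
      have : 0 ≤ max C 1 := zero_le_one.trans (le_max_right _ _)
      gcongr
      linarith

/-- The iteration bound in terms of `rate`. -/
lemma exists_serious_sol_le_rate (hT : T.IsRun (P := P) lam (ε / 2))
    (hP : P ∈ instClass μ Mf R0)
    (hlam : 0 < lam) (hμ : 0 ≤ μ) (hMf : 0 < Mf) (hε : 0 < ε) (hT₁ : 0 ≤ T₁)
    (hc : 0 ≤ c) (hC : lam ≤ C * R0 ^ 2 / ε) {xs : E P.n} (hxs : xs ∈ P.argmin)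
    (hd : ‖P.x0 - xs‖ < 2 * R0)
    (hcyc : ∀ i, T.Serious (P := P) lam (ε / 2) i → ‖T.xc i - xs‖ ≤ ‖P.x0 - xs‖ →
      T.realGap P lam i ≤ T₁)
    (hL : 2 + T₁ / (8 * Mf ^ 2 / (1 / lam + μ)) + 2 * (8 * Mf ^ 2 / (1 / lam + μ)) / (ε / 2) ≤
      c * (Mf ^ 2 / ((1 / lam + μ) * ε))) :
    ∃ N : ℕ, T.Serious (P := P) lam (ε / 2) N ∧ P.IsSol ε (T.z N) ∧
      (N : ℝ) ≤ c * (4 + max C 1) * rate ε Mf R0 μ := by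
  have hmono : c * (4 + C) * (Mf ^ 2 * R0 ^ 2 / ε ^ 2) ≤
      c * (4 + max C 1) * (Mf ^ 2 * R0 ^ 2 / ε ^ 2) := by
    gcongr
    exact le_max_left _ _
  obtain ⟨N, h1, h2, h3⟩ :=
    exists_serious_sol_le_sq hT hP hlam hμ hMf hε hT₁ hc hC hxs hd hcyc hL
  rw [rate]
  split_ifs with h0
  · exact ⟨N, h1, h2, h3.trans hmono⟩
  · rcases min_choice (Mf ^ 2 * R0 ^ 2 / ε ^ 2)
      ((Mf ^ 2 / (μ * ε) + 1) * Real.log (μ * R0 ^ 2 / ε + 1)) with h | h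
    · rw [h]
      exact ⟨N, h1, h2, h3.trans hmono⟩
    · rw [h]
      exact exists_serious_sol_le_log hT hP hlam (lt_of_le_of_ne hμ (Ne.symm h0)) hMf hε hT₁ hc hC
        hxs hd hcyc hL

/-- The slack 2R₀ avoids proving that the distance is attained; it is the source of the factor 4 in
the cycle counts. -/
lemma exists_near_argmin (hP : P ∈ instClass μ Mf R0) (hR0 : 0 < R0) :
    ∃ xs ∈ P.argmin, ‖P.x0 - xs‖ < 2 * R0 := by
  obtain ⟨xs, h1, h2⟩ := (Metric.infDist_lt_iff hP.2.2.1).1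
    (lt_of_le_of_lt hP.2.2.2.2 (by linarith : R0 < 2 * R0))
  exact ⟨xs, h1, by rwa [← dist_eq_norm]⟩

end Bound

/-! ### Optimality -/

lemma rate_nonneg {ε Mf R0 μ : ℝ} (hε : 0 < ε) (hμ : 0 ≤ μ) : 0 ≤ rate ε Mf R0 μ := by
  rw [rate]
  have hlog : 0 ≤ Real.log (μ * R0 ^ 2 / ε + 1) := Real.log_nonneg (by
    have : 0 ≤ μ * R0 ^ 2 / ε := by positivity
    linarith)
  split_ifs
  · positivity
  · exact le_min (by positivity) (by positivity)

/-- The rate is attained by a lower bound, up to the logarithmic factor. -/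
lemma exists_lower_rate {ε Mf R0 μ l : ℝ} (hε : 0 < ε) (hMf : 0 < Mf) (hR0 : 0 < R0)
    (hμ : 0 ≤ μ) (hl : 1 ≤ l) (hlog : Real.log (μ * R0 ^ 2 / ε + 1) ≤ l)
    {I : Set Inst} (hI : instClassU μ Mf R0 ⊆ I) :
    ∃ M, 1 ≤ M ∧ IsClassLower I ε M ∧ rate ε Mf R0 μ ≤ 5 * l * M := by
  have e1 : Mf ^ 2 * R0 ^ 2 / ε ^ 2 = 4 * (Mf ^ 2 * R0 ^ 2 / (4 * ε ^ 2)) := by field_simp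
  have key : ∀ B M : ℝ, 0 ≤ M → B ≤ M → 4 * B ≤ 5 * l * M := by
    intro B M hM hB
    nlinarith
  rcases hμ.eq_or_lt with h0 | h0
  · refine ⟨max 1 (Mf ^ 2 * R0 ^ 2 / (4 * ε ^ 2)), le_max_left _ _,
      isClassLower_max hMf hR0 hμ hε le_rfl ?_ hI, ?_⟩
    · rw [← h0, zero_mul, zero_mul]
      positivity
    · rw [rate, if_pos h0.symm, e1]
      exact key _ _ (zero_le_one.trans (le_max_left _ _)) (le_max_right _ _)
  · rw [rate, if_neg h0.ne']
    -- The two terms are the two constraints of the resisting instance: the distance budget and the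
    -- curvature of h.
    set B := min (Mf ^ 2 * R0 ^ 2 / (4 * ε ^ 2)) (Mf ^ 2 / (2 * (μ * ε))) with hB
    refine ⟨max 1 B, le_max_left _ _, isClassLower_max hMf hR0 hμ hε (min_le_left _ _) ?_ hI, ?_⟩
    · have h1 := mul_le_mul_of_nonneg_left
        (min_le_right (Mf ^ 2 * R0 ^ 2 / (4 * ε ^ 2)) (Mf ^ 2 / (2 * (μ * ε))))
        (by positivity : 0 ≤ 2 * (μ * ε))
      rw [mul_div_cancel₀ _ (by positivity)] at h1
      linarith
    · have hM1 := le_max_left 1 B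
      have hM2 := le_max_right 1 B
      rcases min_choice (Mf ^ 2 * R0 ^ 2 / (4 * ε ^ 2)) (Mf ^ 2 / (2 * (μ * ε))) with h | h
      · refine (min_le_left _ _).trans ?_
        rw [e1, ← h]
        exact key _ _ (zero_le_one.trans hM1) hM2
      · refine (min_le_right _ _).trans ?_
        have e2 : Mf ^ 2 / (μ * ε) = 2 * B := by
          rw [hB, h]
          field_simp
        have hB0 : 0 ≤ B := by
          rw [hB, h]
          positivity
        rw [e2]
        calc (2 * B + 1) * Real.log (μ * R0 ^ 2 / ε + 1) ≤ (2 * B + 1) * l := by gcongr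
          _ ≤ (3 * max 1 B) * l := by gcongr; linarith
          _ ≤ 5 * l * max 1 B := by
              have := mul_nonneg (zero_le_one.trans hl) (zero_le_one.trans hM1)
              linarith

/-- The point ẑ_N is some x_i with i ≤ N, so the first solution among the iterates occurs by then;
the 1 counts x₀. -/
lemma runAlgorithm_J_le {ε : ℝ} {T : (P : Inst) → Trace P.n} {P : Inst} {lam δ : ℝ}
    (hT : (T P).IsRun (P := P) lam δ) {N : ℕ} (hN : P.IsSol ε ((T P).z N)) :
    (∃ i, P.IsSol ε ((T P).x i)) ∧ (runAlgorithm ε T).J P ≤ N + 1 := by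
  obtain ⟨i, hi, h⟩ := exists_z_eq hT N
  rw [h] at hN
  refine ⟨⟨i, hN⟩, Nat.add_le_add_right ((Nat.sInf_le ?_).trans hi) 1⟩
  exact hN

lemma runAlgorithm_mem_algClass {ε μ Mf R0 lam δ : ℝ} {I : Set Inst} (hI : I ⊆ instClass μ Mf R0)
    (hμ : 0 ≤ μ) (hlam : 0 < lam) {T : (P : Inst) → Trace P.n}
    (hT : ∀ P ∈ I, (T P).IsRun (P := P) lam δ)
    (hsol : ∀ P ∈ I, ∃ i, P.IsSol ε ((T P).x i)) : runAlgorithm ε T ∈ algClass I ε := by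
  intro P hP
  have hmem : sInf {j | P.IsSol ε ((T P).x j)} ∈ {j | P.IsSol ε ((T P).x j)} :=
    Nat.sInf_mem (hsol P hP)
  refine ⟨Nat.le_add_left _ _, (hT P hP).x_zero, fun j hj => ⟨fun h => ?_, fun h => ?_⟩,
    fun a b e hh j _ _ => x_sub_mem_span (hT P hP) (hI hP) hμ hlam hh j⟩
  · have h1 : sInf {j | P.IsSol ε ((T P).x j)} ≤ j := Nat.sInf_le h
    change j < sInf {j | P.IsSol ε ((T P).x j)} + 1 at hj
    change j = sInf {j | P.IsSol ε ((T P).x j)} + 1 - 1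
    omega
  · have h1 : j = sInf {j | P.IsSol ε ((T P).x j)} := h
    rw [h1]
    exact hmem

/-- The method itself witnesses the class upper bound M₂ = c · rate + 1. As M ≥ 1 and l ≥ 1, the
lower bound M gives M₂ ≤ (5c + 1) l M, and 6c + 2 leaves room for the remaining claims. -/
lemma rpbOptimal_of_iteration_bound {ε Mf R0 μ lam l c : ℝ} (hε : 0 < ε) (hMf : 0 < Mf)
    (hR0 : 0 < R0) (hμ : 0 ≤ μ) (hlam : 0 < lam) (hc : 0 ≤ c) (hl : 1 ≤ l)
    (hlog : Real.log (μ * R0 ^ 2 / ε + 1) ≤ l) {I : Set Inst} (hIU : instClassU μ Mf R0 ⊆ I)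
    (hI : I ⊆ instClass μ Mf R0)
    (hN : ∀ P ∈ I, ∀ T : Trace P.n, T.IsRun (P := P) lam (ε / 2) →
      ∃ N : ℕ, T.Serious (P := P) lam (ε / 2) N ∧ P.IsSol ε (T.z N) ∧
        (N : ℝ) ≤ c * rate ε Mf R0 μ) :
    RPBOptimal (6 * c + 2) l (rate ε Mf R0 μ) ε lam I := by
  have hr := rate_nonneg (Mf := Mf) (R0 := R0) hε hμ
  refine ⟨fun P hP => ⟨_, canonicalRun_isRun (hI hP) hlam (ε / 2)⟩, fun T hT => ⟨?_, ?_⟩⟩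
  · have hA : runAlgorithm ε T ∈ algClass I ε :=
      runAlgorithm_mem_algClass hI hμ hlam hT fun P hP => by
        obtain ⟨N, _, h2, _⟩ := hN P hP (T P) (hT P hP)
        exact (runAlgorithm_J_le (hT P hP) h2).1
    obtain ⟨M, hM1, hM2, hM3⟩ := exists_lower_rate hε hMf hR0 hμ hl hlog hIU
    have hJ : IsAlgUpper I (runAlgorithm ε T) (c * rate ε Mf R0 μ + 1) := by
      intro P hP
      obtain ⟨N, _, h2, h3⟩ := hN P hP (T P) (hT P hP)
      have h4 : ((runAlgorithm ε T).J P : ℝ) ≤ N + 1 := by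
        exact_mod_cast (runAlgorithm_J_le (hT P hP) h2).2
      linarith
    have hcr : 0 ≤ c * rate ε Mf R0 μ := mul_nonneg hc hr
    refine ⟨hA, M, c * rate ε Mf R0 μ + 1, hM2, ⟨_, hA, hJ⟩, ?_, fun P hP => ?_⟩
    · have h1 := mul_le_mul_of_nonneg_left hM3 hc
      have h2 : 1 ≤ l * M := by nlinarith
      have h3 : 0 ≤ c * (l * M) := mul_nonneg hc (by linarith)
      nlinarith
    · refine (hJ P hP).trans ?_
      nlinarith
  · intro P hP
    obtain ⟨N, h1, h2, h3⟩ := hN P hP (T P) (hT P hP)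
    refine ⟨N, h1, h2, h3.trans ?_⟩
    nlinarith [mul_nonneg hc hr]

/-- The length of a cycle for `R₀ / M_f ≤ λ` and `μ ≤ C' M_f / R₀`. -/
lemma cycle_length_le {C C' ε Mf R0 lam μ : ℝ} (hC : 0 < C) (hC' : 0 < C') (hε : 0 < ε)
    (hMf : 0 < Mf) (hR0 : 0 < R0) (h1 : 1 ≤ C * Mf * R0 / ε) (hlam : 0 < lam)
    (hlam1 : R0 / Mf ≤ lam) (hlam2 : lam ≤ C * R0 ^ 2 / ε) (hμ : 0 ≤ μ)
    (hμ' : μ ≤ C' * Mf / R0) :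
    2 + 12 * lam * Mf ^ 2 / (8 * Mf ^ 2 / (1 / lam + μ)) +
      2 * (8 * Mf ^ 2 / (1 / lam + μ)) / (ε / 2) ≤
      (4 * (C * (1 + C')) + 2 * (C * C' * (1 + C')) + 32) *
        (Mf ^ 2 / ((1 / lam + μ) * ε)) := by
  set W := Mf ^ 2 / ((1 / lam + μ) * ε) with hW
  have hσ : 0 < 1 / lam + μ := by positivity
  have hW0 : 0 ≤ W := by positivity
  have e1 : 12 * lam * Mf ^ 2 / (8 * Mf ^ 2 / (1 / lam + μ)) = 3 / 2 * (1 + lam * μ) := by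
    field_simp
    ring
  have e2 : 2 * (8 * Mf ^ 2 / (1 / lam + μ)) / (ε / 2) = 32 * W := by
    rw [hW]
    field_simp
    ring
  have h2 : Mf * R0 / ε ≤ (1 + C') * W := by
    have h3 : 1 / lam ≤ Mf / R0 := by
      rw [div_le_div_iff₀ hlam hR0]
      rw [div_le_iff₀ hMf] at hlam1
      linarith
    have h4 : 1 / lam + μ ≤ (1 + C') * Mf / R0 := by
      have : (1 + C') * Mf / R0 = Mf / R0 + C' * Mf / R0 := by ring
      linarith
    rw [le_div_iff₀ hR0] at h4
    have e : (1 + C') * W = (1 + C') * Mf ^ 2 / ((1 / lam + μ) * ε) := by rw [hW]; ring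
    rw [e, div_le_div_iff₀ hε (by positivity)]
    have h5 := mul_le_mul_of_nonneg_left h4 (by positivity : 0 ≤ Mf * ε)
    linarith
  -- The assumption CM_fR₀/ε ≥ 1 lets W absorb the constant part of the cycle length.
  have h3 : 1 ≤ C * (1 + C') * W := by
    have := mul_le_mul_of_nonneg_left h2 hC.le
    have e : C * (Mf * R0 / ε) = C * Mf * R0 / ε := by ring
    linarith
  have h4 : lam * μ ≤ C * C' * (1 + C') * W := by
    calc lam * μ ≤ (C * R0 ^ 2 / ε) * (C' * Mf / R0) := by gcongr
      _ = C * C' * (Mf * R0 / ε) := by field_simp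
      _ ≤ C * C' * ((1 + C') * W) := by gcongr
      _ = C * C' * (1 + C') * W := by ring
  have h5 : 0 ≤ lam * μ := mul_nonneg hlam.le hμ
  rw [e1, e2]
  linarith

end CNCO

/-! ### The two step-size regimes -/

theorem mainTheorem5 (C : ℝ) (hC : 0 < C) :
    -- part (a): optimality up to a logarithmic term
    (∀ C' : ℝ, 0 < C' → ∃ c : ℝ, 1 < c ∧
      ∀ ε Mf R0 : ℝ, 0 < ε → 0 ≤ Mf → 0 < R0 → 1 ≤ C * Mf * R0 / ε →
      ∀ lam : ℝ, R0 / Mf ≤ lam → lam ≤ C * R0 ^ 2 / ε →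
      ∀ μ : ℝ, 0 ≤ μ → μ ≤ C' * Mf / R0 →
      ∀ I : Set Inst, instClassU μ Mf R0 ⊆ I → I ⊆ instClass μ Mf R0 →
        RPBOptimal c (max (Real.log (μ * R0 ^ 2 / ε + 1)) 1) (rate ε Mf R0 μ) ε lam I) ∧
    -- part (b): optimality
    (∃ c : ℝ, 1 < c ∧
      ∀ ε Mf R0 : ℝ, 0 < ε → 0 ≤ Mf → 0 < R0 → 1 ≤ C * Mf * R0 / ε →
      ∀ lam : ℝ, ε / (C * Mf ^ 2) ≤ lam → lam ≤ C * R0 ^ 2 / ε →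
      ∀ I : Set Inst, instClassU 0 Mf R0 ⊆ I → I ⊆ instClassLip Mf R0 C →
        RPBOptimal c 1 (rate ε Mf R0 0) ε lam I) := by
  -- The normalization excludes M_f = 0, so the quotients by M_f in the step-size ranges never take
  -- their default value.
  have hMfpos : ∀ {ε Mf R0 : ℝ}, 0 ≤ Mf → 1 ≤ C * Mf * R0 / ε → 0 < Mf := by
    intro ε Mf R0 hMf h
    refine lt_of_le_of_ne hMf ?_
    rintro rfl
    rw [mul_zero, zero_mul, zero_div] at h
    linarith
  have hmax : 0 < max C 1 := lt_max_of_lt_left hC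
  constructor
  · intro C' hC'
    set c₂ := 4 * (C * (1 + C')) + 2 * (C * C' * (1 + C')) + 32 with hc₂
    have hc₂0 : 0 ≤ c₂ := by positivity
    refine ⟨6 * (c₂ * (4 + max C 1)) + 2, ?_, ?_⟩
    · have : 0 ≤ c₂ * (4 + max C 1) := by positivity
      linarith
    intro ε Mf R0 hε hMf0 hR0 h1 lam hlam1 hlam2 μ hμ hμ' I hIU hI
    have hMf := hMfpos hMf0 h1
    have hlam : 0 < lam := lt_of_lt_of_le (by positivity) hlam1
    refine rpbOptimal_of_iteration_bound hε hMf hR0 hμ hlam (by positivity) (le_max_right _ _)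
      (le_max_left _ _) hIU hI fun P hP T hT => ?_
    obtain ⟨xs, hxs, hd⟩ := exists_near_argmin (hI hP) hR0
    refine exists_serious_sol_le_rate hT (hI hP) hlam hμ hMf hε
      (by positivity : 0 ≤ 12 * lam * Mf ^ 2) hc₂0 hlam2 hxs hd (fun i hi hdi => ?_)
      (cycle_length_le hC hC' hε hMf hR0 h1 hlam hlam1 hlam2 hμ hμ')
    -- Centers stay within 2R₀ of `xs`, and R₀ ≤ λM_f.
    refine realGap_le_of_serious hT (hI hP) hlam hμ hMf hi hxs ?_
    rw [div_le_iff₀ hMf] at hlam1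
    linarith
  · set c₂ := C * (2 + (1 + C) / 2) + 32 with hc₂
    have hc₂0 : 0 ≤ c₂ := by positivity
    refine ⟨6 * (c₂ * (4 + max C 1)) + 2, ?_, ?_⟩
    · have : 0 ≤ c₂ * (4 + max C 1) := by positivity
      linarith
    intro ε Mf R0 hε hMf0 hR0 h1 lam hlam1 hlam2 I hIU hI
    have hMf := hMfpos hMf0 h1
    have hlam : 0 < lam := lt_of_lt_of_le (by positivity) hlam1
    refine rpbOptimal_of_iteration_bound hε hMf hR0 le_rfl hlam (by positivity) le_rfl
      (by simp) hIU (fun P hP => (hI hP).1) fun P hP T hT => ?_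
    obtain ⟨hP0, Mh, _, hMh, h4⟩ := hI hP
    obtain ⟨xs, hxs, hd⟩ := exists_near_argmin hP0 hR0
    refine exists_serious_sol_le_rate hT hP0 hlam le_rfl hMf hε
      (by positivity : 0 ≤ 4 * (1 + C) * lam * Mf ^ 2) hc₂0 hlam2 hxs hd
      (fun i hi _ => realGap_le_of_lipschitz hT hP0 hlam le_rfl hMf hMh h4 hi hC) ?_
    rw [add_zero]
    have e1 : 4 * (1 + C) * lam * Mf ^ 2 / (8 * Mf ^ 2 / (1 / lam)) = (1 + C) / 2 := by
      field_simp
      norm_num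
    have e2 : 2 * (8 * Mf ^ 2 / (1 / lam)) / (ε / 2) = 32 * (Mf ^ 2 / (1 / lam * ε)) := by
      field_simp
      norm_num
    -- This is the lower bound on λ restated; it absorbs the constant part 2 + (1 + C)/2 of the
    -- cycle length.
    have h5 : 1 ≤ C * (Mf ^ 2 / (1 / lam * ε)) := by
      rw [div_le_iff₀ (by positivity)] at hlam1
      have e : C * (Mf ^ 2 / (1 / lam * ε)) = lam * (C * Mf ^ 2) / ε := by field_simp
      rw [e, le_div_iff₀ hε]
      linarith
    rw [e1, e2, hc₂]
    nlinarith
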